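/- **Setting.** A *quantum Markov decision process* (qMDP) $\mathcal M=\langle\mathcal H,Act,\mathbf M,Q\rangle$ consists of a Hilbert space $\mathcal H=\mathbb C^d$; a finite set $Act$ of actions, each $\alpha\in Act$ with a trace-preserving super-operator $\mathcal E_\alpha(\rho)=\sum_{i=1}^{n_\alpha}A_{\alpha i}\rho A_{\alpha i}^\dagger$, $\sum_i A_{\alpha i}^\dagger A_{\alpha i}=I$; a finite set $\mathbf M$ of quantum measurements $M_\beta=\{M_{\beta 1},\dots,M_{\beta k_\beta}\}$, $\sum_j M_{\beta j}^\dagger M_{\beta j}=I$; and a map $Q:Act\cup\mathbf M\to 2^{Act\cup\mathbf M}$ giving the actions and measurements available after each action or measurement. Let $\Omega$ be the set of pairs (measurement, outcome). A *scheduler* is a function $\mathfrak S:(Act\cup\Omega)^*\to Act\cup\mathbf M$ that, after every non-empty history that can arise from its own choices, selects an element available according to $Q$ after the last action or measurement performed (the first choice is free; if $Q$ is trivial, i.e. always equal to $Act\cup\mathbf M$, every function is a scheduler). Given an initial density matrix $\rho$ and a scheduler $\mathfrak S$, put $\rho_\epsilon=\rho$, $p_\epsilon=1$; if $\mathfrak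 S(w)=\alpha\in Act$, put $\rho_{w\alpha}=\mathcal E_\alpha(\rho_w)$, $p_{w\alpha}=p_w$; if $\mathfrak S(w)=M_\beta$ and $o$ is the outcome $j$ of $M_\beta$, put $p_{wo}=p_w\,\mathrm{tr}(M_{\beta j}\rho_wM_{\beta j}^\dagger)$ and $\rho_{wo}=M_{\beta j}\rho_wM_{\beta j}^\dagger/\mathrm{tr}(M_{\beta j}\rho_wM_{\beta j}^\dagger)$; all other words have probability $0$. Let $\rho(n,\mathfrak S)=\sum_{|w|=n}p_w\rho_w$, and for a subspace $B\subseteq\mathcal H$ with orthogonal projection $P_B$ let $\Pr^{\mathfrak S}(\rho\vDash\Diamond B)=\lim_{n\to\infty}\mathrm{tr}(P_B\,\rho(n,\mathfrak S))$. The subspace $B$ is *invariant* if, for every density matrix $\rho$ with $\mathrm{supp}(\rho)\subseteq B$, the supports of all $\mathcal E_\alpha(\rho)$ and of all $M_{\beta j}\rho M_{\beta j}^\dagger$ are contained in $B$; then the limit exists. **Theorem.** Consider qMDPs $\mathcal M$ and invariant subspaces $B$ such that all operators $A_{\alpha i}$ and $M_{\beta j}$ are of the form $a\,|\varphi\rangle\langle\psi|$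 with $a\in\mathbb C$, and let $N=\max(\{n_\alpha:\alpha\in Act\}\cup\{k_\beta:M_\beta\in\mathbf M\})$. There are one algorithm and one polynomial $p$ such that, for every such $\mathcal M$ and $B$, the algorithm decides whether $\Pr^{\mathfrak S}(\rho\vDash\Diamond B)=1$ holds for all schedulers $\mathfrak S$ and all initial states $\rho$, in time at most $p\big((|Act|+|\mathbf M|)\,2^N\big)$. Here time is the number of steps of a unit-cost real random access machine (exact arithmetic operations and comparisons of real numbers with constants $0,1$; addition, subtraction and comparison of natural numbers; array access). The input consists of $d$, $|Act|$, $|\mathbf M|$, the numbers $n_\alpha,k_\beta$, the table of $Q$, and the real and imaginary parts of the entries of $P_B$ and of all $A_{\alpha i}$, $M_{\beta j}$. -/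

import Mathlib

open Matrix Filter Topology
open scoped ComplexOrder

/-! ### Quantum Markov decision processes -/

namespace QMDP

/-- A finite family of `d × d` matrices `E₁, …, E_len` with `∑ Eᵢ† Eᵢ = I`: the Kraus operators of a
trace-preserving super-operator, or the measurement operators of a quantum measurement. -/
structure OpFamily (d : ℕ) where
  len : ℕ
  op : Fin len → Matrix (Fin d) (Fin d) ℂ
  complete : ∑ i, (op i)ᴴ * op i = 1

/-- The super-operator `ρ ↦ ∑ Eᵢ ρ Eᵢ†`. -/
noncomputable def OpFamily.superOp {d : ℕ} (E : OpFamily d) (ρ : Matrix (Fin d) (Fin d) ℂ) :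
    Matrix (Fin d) (Fin d) ℂ :=
  ∑ i, E.op i * ρ * (E.op i)ᴴ

/-- Every operator of the family has the form `a |φ⟩⟨ψ|`. -/
def OpFamily.RankOne {d : ℕ} (E : OpFamily d) : Prop :=
  ∀ i, ∃ (a : ℂ) (φ ψ : Fin d → ℂ), E.op i = a • vecMulVec φ (star ψ)

end QMDP

/-- A quantum Markov decision process `⟨ℂ^dim, Act, 𝐌, Q⟩` with `numAct` actions, given by Kraus
operators, `numMeas` measurements, and availability map `Q = avail`. -/
structure QMDP where
  dim : ℕ
  numAct : ℕ
  numMeas : ℕ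
  act : Fin numAct → QMDP.OpFamily dim
  meas : Fin numMeas → QMDP.OpFamily dim
  avail : Fin numAct ⊕ Fin numMeas → Finset (Fin numAct ⊕ Fin numMeas)

namespace QMDP

/-- The set `Act ∪ 𝐌`. -/
abbrev Choice (M : QMDP) : Type := Fin M.numAct ⊕ Fin M.numMeas

/-- The set `Act ∪ Ω`: actions and pairs (measurement, outcome). -/
abbrev Event (M : QMDP) : Type :=
  Fin M.numAct ⊕ (Σ β : Fin M.numMeas, Fin (M.meas β).len)

/-- The action or measurement that produced an event. -/
def choiceOf (M : QMDP) : M.Event → M.Choice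
  | Sum.inl α => Sum.inl α
  | Sum.inr o => Sum.inr o.1

/-- The operators attached to an action or a measurement. -/
def fam (M : QMDP) : M.Choice → OpFamily M.dim
  | Sum.inl α => M.act α
  | Sum.inr β => M.meas β

/-- A scheduler maps histories in `(Act ∪ Ω)*` to `Act ∪ 𝐌`. Histories are written with the most
recent event at the head of the list. -/
abbrev Scheduler (M : QMDP) : Type := List M.Event → M.Choice

/-- The history can occur under the scheduler: each event comes from the choice made before it. -/
def Consistent (M : QMDP) (S : M.Scheduler) : List M.Event → Prop
  | [] => True
  | e :: w => S w = M.choiceOf e ∧ M.Consistent S w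

/-- The scheduler only makes choices that `Q` makes available after the last event (the first choice
is free). If `Q` is trivial (`avail x = univ` for all `x`), every scheduler is admissible. -/
def Admissible (M : QMDP) (S : M.Scheduler) : Prop :=
  ∀ e w, M.Consistent S (e :: w) → S (e :: w) ∈ M.avail (M.choiceOf e)

/-- Density matrices. -/
def IsDensity {d : ℕ} (ρ : Matrix (Fin d) (Fin d) ℂ) : Prop :=
  ρ.PosSemidef ∧ ρ.trace = 1

/-- The support of a positive semidefinite matrix. -/
noncomputable def supp {d : ℕ} (ρ : Matrix (Fin d) (Fin d) ℂ) :
    Submodule ℂ (EuclideanSpace ℂ (Fin d)) :=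
  LinearMap.range (Matrix.toEuclideanLin ρ)

/-- The matrix of the orthogonal projection `P_B`. -/
noncomputable def projMatrix {d : ℕ} (B : Submodule ℂ (EuclideanSpace ℂ (Fin d))) :
    Matrix (Fin d) (Fin d) ℂ :=
  Matrix.toEuclideanLin.symm
    (B.starProjection : EuclideanSpace ℂ (Fin d) →ₗ[ℂ] EuclideanSpace ℂ (Fin d))

/-- `(ρ_w, p_w)`: the state after the history `w`, and its probability. Histories that do not follow
the scheduler have probability `0`; so have outcomes with `tr (M_m ρ_w M_m†) = 0`, for which the
value of the state is irrelevant. -/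
noncomputable def config (M : QMDP) (S : M.Scheduler) (ρ : Matrix (Fin M.dim) (Fin M.dim) ℂ) :
    List M.Event → Matrix (Fin M.dim) (Fin M.dim) ℂ × ℝ
  | [] => (ρ, 1)
  | Sum.inl α :: w =>
      if S w = Sum.inl α then ((M.act α).superOp (M.config S ρ w).1, (M.config S ρ w).2)
      else (0, 0)
  | Sum.inr ⟨β, j⟩ :: w =>
      if S w = Sum.inr β then
        let σ := (M.meas β).op j * (M.config S ρ w).1 * ((M.meas β).op j)ᴴ
        ((σ.trace)⁻¹ • σ, (M.config S ρ w).2 * σ.trace.re)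
      else (0, 0)

/-- The global state `ρ(n, S) = ∑_{|w| = n} p_w ρ_w`. -/
noncomputable def globalState (M : QMDP) (S : M.Scheduler)
    (ρ : Matrix (Fin M.dim) (Fin M.dim) ℂ) (n : ℕ) : Matrix (Fin M.dim) (Fin M.dim) ℂ :=
  ∑ w : Fin n → M.Event,
    ((M.config S ρ (List.ofFn w)).2 : ℂ) • (M.config S ρ (List.ofFn w)).1

/-- `Pr(ρ(n, S) ⊨ B) = tr (P_B ρ(n, S))`. -/
noncomputable def probAt (M : QMDP) (S : M.Scheduler) (ρ : Matrix (Fin M.dim) (Fin M.dim) ℂ)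
    (B : Submodule ℂ (EuclideanSpace ℂ (Fin M.dim))) (n : ℕ) : ℝ :=
  (projMatrix B * M.globalState S ρ n).trace.re

/-- `Pr^S(ρ ⊨ ◇B) = p`, the reachability probability being the limit of `Pr(ρ(n, S) ⊨ B)`. -/
def HasReachProb (M : QMDP) (S : M.Scheduler) (ρ : Matrix (Fin M.dim) (Fin M.dim) ℂ)
    (B : Submodule ℂ (EuclideanSpace ℂ (Fin M.dim))) (p : ℝ) : Prop :=
  Tendsto (M.probAt S ρ B) atTop (𝓝 p)

/-- `B` is an invariant subspace of `M`. -/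
def Invariant (M : QMDP) (B : Submodule ℂ (EuclideanSpace ℂ (Fin M.dim))) : Prop :=
  (∀ α, ∀ ρ, IsDensity ρ → supp ρ ≤ B → supp ((M.act α).superOp ρ) ≤ B) ∧
  (∀ β j, ∀ ρ, IsDensity ρ → supp ρ ≤ B →
    supp ((M.meas β).op j * ρ * ((M.meas β).op j)ᴴ) ≤ B)

/-- `Pr^S(ρ ⊨ ◇B) = 1` for all schedulers `S` and all initial states `ρ`. -/
def AlwaysReaches (M : QMDP) (B : Submodule ℂ (EuclideanSpace ℂ (Fin M.dim))) : Prop :=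
  ∀ S : M.Scheduler, M.Admissible S → ∀ ρ, IsDensity ρ → M.HasReachProb S ρ B 1

/-- `N = max ({n_α} ∪ {k_β})` (and `0` if there are neither actions nor measurements). -/
def maxLen (M : QMDP) : ℕ := Finset.univ.sup fun x : M.Choice => (M.fam x).len

end QMDP

/-! ### Real random access machines

Programs with finitely many arrays of natural numbers (for indices and flags, with addition and
truncated subtraction) and of real numbers (with exact arithmetic and comparison), under the unit-cost
measure: each constant, array access, arithmetic operation, comparison and assignment is one step.
The only real constants are `0` and `1`, and reals cannot be turned into natural numbers. -/

namespace RealRAM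

/-- Contents of the arrays: `nat a i` is cell `i` of the `a`-th array of natural numbers. -/
structure Store where
  nat : ℕ → ℕ → ℕ
  real : ℕ → ℕ → ℝ

inductive NatExpr where
  | lit (n : ℕ)
  | read (arr : ℕ) (i : NatExpr)
  | add (e f : NatExpr)
  | sub (e f : NatExpr)

inductive RealExpr where
  | zero
  | one
  | read (arr : ℕ) (i : NatExpr)
  | add (x y : RealExpr)
  | sub (x y : RealExpr)
  | mul (x y : RealExpr)
  | div (x y : RealExpr)

inductive Test where
  | natEq (e f : NatExpr)
  | natLt (e f : NatExpr)
  | realEq (x y : RealExpr)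
  | realLt (x y : RealExpr)

inductive Prog where
  | skip
  | setNat (arr : ℕ) (i e : NatExpr)
  | setReal (arr : ℕ) (i : NatExpr) (x : RealExpr)
  | seq (p q : Prog)
  | ite (b : Test) (p q : Prog)
  | while (b : Test) (p : Prog)

def NatExpr.val (s : Store) : NatExpr → ℕ
  | lit n => n
  | read arr i => s.nat arr (i.val s)
  | add e f => e.val s + f.val s
  | sub e f => e.val s - f.val s

def NatExpr.cost : NatExpr → ℕ
  | lit _ => 1
  | read _ i => i.cost + 1
  | add e f => e.cost + f.cost + 1
  | sub e f => e.cost + f.cost + 1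

/-- Division by zero returns zero. -/
noncomputable def RealExpr.val (s : Store) : RealExpr → ℝ
  | zero => 0
  | one => 1
  | read arr i => s.real arr (i.val s)
  | add x y => x.val s + y.val s
  | sub x y => x.val s - y.val s
  | mul x y => x.val s * y.val s
  | div x y => x.val s / y.val s

def RealExpr.cost : RealExpr → ℕ
  | zero => 1
  | one => 1
  | read _ i => i.cost + 1
  | add x y => x.cost + y.cost + 1
  | sub x y => x.cost + y.cost + 1
  | mul x y => x.cost + y.cost + 1
  | div x y => x.cost + y.cost + 1

def Test.holds (s : Store) : Test → Prop
  | natEq e f => e.val s = f.val s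
  | natLt e f => e.val s < f.val s
  | realEq x y => x.val s = y.val s
  | realLt x y => x.val s < y.val s

def Test.cost : Test → ℕ
  | natEq e f => e.cost + f.cost + 1
  | natLt e f => e.cost + f.cost + 1
  | realEq x y => x.cost + y.cost + 1
  | realLt x y => x.cost + y.cost + 1

def Store.setNat (s : Store) (arr i v : ℕ) : Store :=
  { s with nat := Function.update s.nat arr (Function.update (s.nat arr) i v) }

def Store.setReal (s : Store) (arr i : ℕ) (v : ℝ) : Store :=
  { s with real := Function.update s.real arr (Function.update (s.real arr) i v) }

/-- `Exec p s s' t`: started in `s`, the program `p` halts in `s'` after `t` steps. -/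
inductive Exec : Prog → Store → Store → ℕ → Prop
  | skip (s : Store) : Exec Prog.skip s s 1
  | setNat (arr : ℕ) (i e : NatExpr) (s : Store) :
      Exec (Prog.setNat arr i e) s (s.setNat arr (i.val s) (e.val s)) (i.cost + e.cost + 1)
  | setReal (arr : ℕ) (i : NatExpr) (x : RealExpr) (s : Store) :
      Exec (Prog.setReal arr i x) s (s.setReal arr (i.val s) (x.val s)) (i.cost + x.cost + 1)
  | seq {p q : Prog} {s s₁ s₂ : Store} {t₁ t₂ : ℕ} :
      Exec p s s₁ t₁ → Exec q s₁ s₂ t₂ → Exec (Prog.seq p q) s s₂ (t₁ + t₂)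
  | ite_true {b : Test} {p q : Prog} {s s' : Store} {t : ℕ} :
      b.holds s → Exec p s s' t → Exec (Prog.ite b p q) s s' (b.cost + t)
  | ite_false {b : Test} {p q : Prog} {s s' : Store} {t : ℕ} :
      ¬ b.holds s → Exec q s s' t → Exec (Prog.ite b p q) s s' (b.cost + t)
  | while_true {b : Test} {p : Prog} {s s₁ s₂ : Store} {t₁ t₂ : ℕ} :
      b.holds s → Exec p s s₁ t₁ → Exec (Prog.while b p) s₁ s₂ t₂ →
      Exec (Prog.while b p) s s₂ (b.cost + t₁ + t₂)
  | while_false {b : Test} {p : Prog} {s : Store} :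
      ¬ b.holds s → Exec (Prog.while b p) s s b.cost

/-- Started in `s`, the program halts within `T` steps and answers whether `P` holds: cell `0` of
the natural number array `0` ends up being `1` if `P` is true and `0` if `P` is false. -/
def DecidesWithin (p : Prog) (s : Store) (P : Prop) (T : ℕ) : Prop :=
  ∃ (s' : Store) (t : ℕ), Exec p s s' t ∧ t ≤ T ∧
    (P → s'.nat 0 0 = 1) ∧ (¬ P → s'.nat 0 0 = 0)

end RealRAM

/-! ### The input of the decision problem -/

namespace QMDP

/-- `Act ∪ 𝐌` as a list, the actions first. -/
def choices (M : QMDP) : List M.Choice :=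
  (List.finRange M.numAct).map Sum.inl ++ (List.finRange M.numMeas).map Sum.inr

/-- The entries of a matrix, row by row, each as real part followed by imaginary part. -/
def matrixEntries {d : ℕ} (A : Matrix (Fin d) (Fin d) ℂ) : List ℝ :=
  (List.finRange d).flatMap fun r => (List.finRange d).flatMap fun c => [(A r c).re, (A r c).im]

/-- The initial store for the input `(M, B)`. Natural number arrays: `1` holds `dim`, `|Act|`,
`|𝐌|`; `2` holds the numbers of operators `n_α` and `k_β`; `3` holds the table of `Q`. Real arrays:
`0` holds the matrix of `P_B`, `1` holds all the operators, family after family. All other cells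
are `0`. -/
noncomputable def inputStore (M : QMDP) (B : Submodule ℂ (EuclideanSpace ℂ (Fin M.dim))) :
    RealRAM.Store where
  nat arr i := match arr with
    | 1 => [M.dim, M.numAct, M.numMeas].getD i 0
    | 2 => (M.choices.map fun x => (M.fam x).len).getD i 0
    | 3 => (M.choices.flatMap fun x =>
        M.choices.map fun y => if y ∈ M.avail x then 1 else 0).getD i 0
    | _ => 0
  real arr i := match arr with
    | 0 => (matrixEntries (projMatrix B)).getD i 0
    | 1 => (M.choices.flatMap fun x =>
        (List.finRange (M.fam x).len).flatMap fun k => matrixEntries ((M.fam x).op k)).getD i 0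
    | _ => 0

end QMDP

namespace RealRAM

/-- Started in `s`, the program halts within `T` steps in a store satisfying `Q`. -/
def Runs (p : Prog) (s : Store) (T : ℕ) (Q : Store → Prop) : Prop :=
  ∃ s' t, Exec p s s' t ∧ t ≤ T ∧ Q s'

theorem Runs.mono {p : Prog} {s : Store} {T T' : ℕ} {Q Q' : Store → Prop} (h : Runs p s T Q)
    (hT : T ≤ T') (hQ : ∀ s', Q s' → Q' s') : Runs p s T' Q' := by
  obtain ⟨s', t, he, ht, hq⟩ := h
  exact ⟨s', t, he, ht.trans hT, hQ _ hq⟩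

theorem Runs.skip {s : Store} {Q : Store → Prop} (h : Q s) : Runs Prog.skip s 1 Q :=
  ⟨s, 1, Exec.skip s, le_rfl, h⟩

theorem Runs.setNat {arr : ℕ} {i e : NatExpr} {s : Store} {Q : Store → Prop}
    (h : Q (s.setNat arr (i.val s) (e.val s))) :
    Runs (Prog.setNat arr i e) s (i.cost + e.cost + 1) Q :=
  ⟨_, _, Exec.setNat arr i e s, le_rfl, h⟩

theorem Runs.setReal {arr : ℕ} {i : NatExpr} {x : RealExpr} {s : Store} {Q : Store → Prop}
    (h : Q (s.setReal arr (i.val s) (x.val s))) :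
    Runs (Prog.setReal arr i x) s (i.cost + x.cost + 1) Q :=
  ⟨_, _, Exec.setReal arr i x s, le_rfl, h⟩

theorem Runs.seq {p q : Prog} {s : Store} {T₁ T₂ : ℕ} {Q R : Store → Prop} (hp : Runs p s T₁ Q)
    (hq : ∀ s', Q s' → Runs q s' T₂ R) : Runs (Prog.seq p q) s (T₁ + T₂) R := by
  obtain ⟨s₁, t₁, he, ht, h⟩ := hp
  obtain ⟨s₂, t₂, he', ht', h'⟩ := hq s₁ h
  exact ⟨s₂, _, Exec.seq he he', Nat.add_le_add ht ht', h'⟩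

theorem Runs.ite {b : Test} {p q : Prog} {s : Store} {T : ℕ} {Q : Store → Prop}
    (hp : b.holds s → Runs p s T Q) (hq : ¬ b.holds s → Runs q s T Q) :
    Runs (Prog.ite b p q) s (b.cost + T) Q := by
  by_cases hb : b.holds s
  · obtain ⟨s', t, he, ht, h⟩ := hp hb
    exact ⟨s', _, Exec.ite_true hb he, Nat.add_le_add_left ht _, h⟩
  · obtain ⟨s', t, he, ht, h⟩ := hq hb
    exact ⟨s', _, Exec.ite_false hb he, Nat.add_le_add_left ht _, h⟩

/-- A loop with an invariant `I` indexed by the number of rounds done so far. -/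
theorem Runs.while {b : Test} {p : Prog} {T n : ℕ} (I : ℕ → Store → Prop)
    (hb : ∀ i s, I i s → i ≤ n → (b.holds s ↔ i < n))
    (hs : ∀ i s, i < n → I i s → Runs p s T (I (i + 1))) {s : Store} (h0 : I 0 s) :
    Runs (Prog.while b p) s (n * (b.cost + T) + b.cost) (I n) := by
  suffices H : ∀ m i s, i + m = n → I i s →
      Runs (Prog.while b p) s (m * (b.cost + T) + b.cost) (I n) from H n 0 s (by omega) h0
  intro m
  induction m with
  | zero =>
    intro i s hi h
    obtain rfl : i = n := by omega
    exact ⟨s, _, Exec.while_false (by rw [hb i s h le_rfl]; exact lt_irrefl _), by omega, h⟩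
  | succ m ih =>
    intro i s hi h
    obtain ⟨s₁, t₁, he, ht, h₁⟩ := hs i s (by omega) h
    obtain ⟨s₂, t₂, he', ht', h₂⟩ := ih (i + 1) s₁ (by omega) h₁
    refine ⟨s₂, _, Exec.while_true ((hb i s h (by omega)).2 (by omega)) he he', ?_, h₂⟩
    rw [Nat.succ_mul]
    omega

@[simp] theorem setNat_nat (s : Store) (a i v b : ℕ) :
    (s.setNat a i v).nat b = if b = a then Function.update (s.nat a) i v else s.nat b := by
  by_cases h : b = a
  · subst h; simp [Store.setNat]
  · simp [Store.setNat, h]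

@[simp] theorem setNat_real (s : Store) (a i v : ℕ) : (s.setNat a i v).real = s.real := rfl

@[simp] theorem setReal_nat (s : Store) (a i : ℕ) (v : ℝ) : (s.setReal a i v).nat = s.nat := rfl

@[simp] theorem setReal_real (s : Store) (a i : ℕ) (v : ℝ) (b : ℕ) :
    (s.setReal a i v).real b = if b = a then Function.update (s.real a) i v else s.real b := by
  by_cases h : b = a
  · subst h; simp [Store.setReal]
  · simp [Store.setReal, h]

/-! ### An expression language with bounded sums

Expressions are evaluated in an environment of read-only tables, and variables with numerical names.
All sums range over the numbers below the bound stored in cell `3` of table `0`. -/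

mutual
/-- Expressions for natural numbers. -/
inductive NE where
  | lit (n : ℕ)
  | var (v : ℕ)
  | read (a : ℕ) (e : NE)
  | add (e f : NE)
  | sub (e f : NE)
  | cond (e f : NE)
  | mul (e f : NE)
  | sum (v : ℕ) (b : NE)
  | ne0 (x : RE)
/-- Expressions for real numbers. -/
inductive RE where
  | read (a : Bool) (e : NE)
  | add (x y : RE)
  | sub (x y : RE)
  | mul (x y : RE)
  | cond (e : NE) (x : RE)
  | sum (v : ℕ) (x : RE)
end

/-- The read-only tables of natural and of real numbers. -/
structure Tables where
  nat : ℕ → ℕ → ℕ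
  real : Bool → ℕ → ℝ

/-- The range of all sums. -/
abbrev Tables.bound (G : Tables) : ℕ := G.nat 0 3

open Classical in
mutual
/-- The value of an expression; the first factor of a product is cut off at the bound. -/
noncomputable def NE.eval (G : Tables) (v : ℕ → ℕ) : NE → ℕ
  | .lit n => n
  | .var x => v x
  | .read a e => G.nat a (e.eval G v)
  | .add e f => e.eval G v + f.eval G v
  | .sub e f => e.eval G v - f.eval G v
  | .cond e f => if e.eval G v ≠ 0 then f.eval G v else 0
  | .mul e f => min (e.eval G v) G.bound * f.eval G v
  | .sum x b => ∑ i ∈ Finset.range G.bound, b.eval G (Function.update v x i)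
  | .ne0 x => if x.eval G v = 0 then 0 else 1
/-- The value of a real expression. -/
noncomputable def RE.eval (G : Tables) (v : ℕ → ℕ) : RE → ℝ
  | .read a e => G.real a (e.eval G v)
  | .add x y => x.eval G v + y.eval G v
  | .sub x y => x.eval G v - y.eval G v
  | .mul x y => x.eval G v * y.eval G v
  | .cond e x => if e.eval G v ≠ 0 then x.eval G v else 0
  | .sum z x => ∑ i ∈ Finset.range G.bound, x.eval G (Function.update v z i)
end

/-- The array of the machine that holds a table. Array `0` is the stack, array `4` holds the
variables, and array `5` is an auxiliary array. -/
def tableArray (a : ℕ) : ℕ := if a < 3 then a + 1 else a + 3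

/-- The real array that holds a table. Array `2` is the stack. -/
def realTableArray (a : Bool) : ℕ := if a then 1 else 0

/-- The store holds the given tables and values of the variables. -/
structure Represents (s : Store) (G : Tables) (v : ℕ → ℕ) : Prop where
  var : s.nat 4 = v
  nat : ∀ a, s.nat (tableArray a) = G.nat a
  real : ∀ a, s.real (realTableArray a) = G.real a

/-- The stores differ at most on the stacks, from cell `k` on. -/
structure SameBelow (k : ℕ) (s s' : Store) : Prop where
  nat : ∀ a, a ≠ 0 → s'.nat a = s.nat a
  stack : ∀ j < k, s'.nat 0 j = s.nat 0 j
  real : ∀ a, a ≠ 2 → s'.real a = s.real a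
  realStack : ∀ j < k, s'.real 2 j = s.real 2 j

theorem tableArray_ne_zero (a : ℕ) : tableArray a ≠ 0 := by unfold tableArray; split <;> omega
theorem tableArray_ne_four (a : ℕ) : tableArray a ≠ 4 := by unfold tableArray; split <;> omega
theorem tableArray_ne_five (a : ℕ) : tableArray a ≠ 5 := by unfold tableArray; split <;> omega
theorem tableArray_inj {a b : ℕ} : tableArray a = tableArray b ↔ a = b := by
  unfold tableArray; split <;> split <;> omega
theorem realTableArray_ne_two (a : Bool) : realTableArray a ≠ 2 := by cases a <;> simp [realTableArray]

theorem SameBelow.refl (k : ℕ) (s : Store) : SameBelow k s s := ⟨fun _ _ => rfl, fun _ _ => rfl, fun _ _ => rfl, fun _ _ => rfl⟩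

theorem SameBelow.trans {k k' : ℕ} {s s' s'' : Store} (h : SameBelow k s s') (h' : SameBelow k' s' s'')
    (hk : k ≤ k') : SameBelow k s s'' :=
  ⟨fun a ha => (h'.nat a ha).trans (h.nat a ha),
    fun j hj => (h'.stack j (by omega)).trans (h.stack j hj),
    fun a ha => (h'.real a ha).trans (h.real a ha),
    fun j hj => (h'.realStack j (by omega)).trans (h.realStack j hj)⟩

theorem SameBelow.setNat {k : ℕ} {s s' : Store} (h : SameBelow k s s') {j x : ℕ} (hj : k ≤ j) :
    SameBelow k s (s'.setNat 0 j x) := by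
  refine ⟨fun a ha => ?_, fun i hi => ?_, h.real, h.realStack⟩
  · simpa [ha] using h.nat a ha
  · have : i ≠ j := by omega
    simpa [this] using h.stack i hi

theorem SameBelow.setReal {k : ℕ} {s s' : Store} (h : SameBelow k s s') {j : ℕ} {x : ℝ} (hj : k ≤ j) :
    SameBelow k s (s'.setReal 2 j x) := by
  refine ⟨h.nat, h.stack, fun a ha => ?_, fun i hi => ?_⟩
  · simpa [ha] using h.real a ha
  · have : i ≠ j := by omega
    simpa [this] using h.realStack i hi

theorem SameBelow.represents {k : ℕ} {s s' : Store} (h : SameBelow k s s') {G : Tables} {v : ℕ → ℕ}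
    (hs : Represents s G v) : Represents s' G v :=
  ⟨(h.nat 4 (by decide)).trans hs.var, fun a => (h.nat _ (tableArray_ne_zero a)).trans (hs.nat a),
    fun a => (h.real _ (realTableArray_ne_two a)).trans (hs.real a)⟩

/-- Cell `k` of the stack. -/
abbrev top (k : ℕ) : NatExpr := .read 0 (.lit k)

/-- Cell `k` of the real stack. -/
abbrev rtop (k : ℕ) : RealExpr := .read 2 (.lit k)

/-- The cell that holds the bound. -/
abbrev boundCell : NatExpr := .read 1 (.lit 3)

/-- Run `p` for all values of variable `v`; the loop uses the cells `k + 1` and `k + 2` of the stack. -/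
def sumLoop (k v : ℕ) (p : Prog) : Prog :=
  .seq (.setNat 0 (.lit (k + 1)) (.read 4 (.lit v))) <|
  .seq (.setNat 0 (.lit (k + 2)) (.lit 0)) <|
  .seq (.while (.natLt (top (k + 2)) boundCell)
      (.seq (.setNat 4 (.lit v) (top (k + 2))) (.seq p
        (.setNat 0 (.lit (k + 2)) (.add (top (k + 2)) (.lit 1)))))) <|
  .setNat 4 (.lit v) (top (k + 1))

/-- The cost of `sumLoop`, given the range and the cost of the body. -/
noncomputable def loopBound (c : Polynomial ℕ) : Polynomial ℕ := Polynomial.X * (c + 30) + 30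

mutual
/-- Compiled code, which leaves the value in cell `k` of the stack. -/
def NE.comp (k : ℕ) : NE → Prog
  | .lit n => .setNat 0 (.lit k) (.lit n)
  | .var v => .setNat 0 (.lit k) (.read 4 (.lit v))
  | .read a e => .seq (e.comp k) (.setNat 0 (.lit k) (.read (tableArray a) (top k)))
  | .add e f => .seq (e.comp k) (.seq (f.comp (k + 1))
      (.setNat 0 (.lit k) (.add (top k) (top (k + 1)))))
  | .sub e f => .seq (e.comp k) (.seq (f.comp (k + 1))
      (.setNat 0 (.lit k) (.sub (top k) (top (k + 1)))))
  | .cond e f => .seq (e.comp k) (.ite (.natLt (.lit 0) (top k)) (f.comp k) .skip)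
  | .mul e f => .seq (e.comp k) <| .seq (f.comp (k + 1)) <|
      .seq (.setNat 0 (.lit (k + 2)) (.lit 0)) <| .seq (.setNat 0 (.lit (k + 3)) (.lit 0)) <|
      .seq (.while (.natLt (top (k + 2)) boundCell)
        (.seq (.ite (.natLt (top (k + 2)) (top k))
            (.setNat 0 (.lit (k + 3)) (.add (top (k + 3)) (top (k + 1)))) .skip)
          (.setNat 0 (.lit (k + 2)) (.add (top (k + 2)) (.lit 1))))) <|
      .setNat 0 (.lit k) (top (k + 3))
  | .sum v b => .seq (.setNat 0 (.lit k) (.lit 0)) <| sumLoop k v <|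
      .seq (b.comp (k + 3)) (.setNat 0 (.lit k) (.add (top k) (top (k + 3))))
  | .ne0 x => .seq (x.comp k) (.ite (.realEq (rtop k) .zero)
      (.setNat 0 (.lit k) (.lit 0)) (.setNat 0 (.lit k) (.lit 1)))
/-- Compiled code, which leaves the value in cell `k` of the real stack. -/
def RE.comp (k : ℕ) : RE → Prog
  | .read a e => .seq (e.comp k) (.setReal 2 (.lit k) (.read (realTableArray a) (top k)))
  | .add x y => .seq (x.comp k) (.seq (y.comp (k + 1))
      (.setReal 2 (.lit k) (.add (rtop k) (rtop (k + 1)))))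
  | .sub x y => .seq (x.comp k) (.seq (y.comp (k + 1))
      (.setReal 2 (.lit k) (.sub (rtop k) (rtop (k + 1)))))
  | .mul x y => .seq (x.comp k) (.seq (y.comp (k + 1))
      (.setReal 2 (.lit k) (.mul (rtop k) (rtop (k + 1)))))
  | .cond e x => .seq (e.comp k) (.ite (.natLt (.lit 0) (top k)) (x.comp k)
      (.setReal 2 (.lit k) .zero))
  | .sum v x => .seq (.setReal 2 (.lit k) .zero) <| sumLoop k v <|
      .seq (x.comp (k + 3)) (.setReal 2 (.lit k) (.add (rtop k) (rtop (k + 3))))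
end

mutual
/-- A bound for the running time of the compiled code, as a polynomial in the range of the sums. -/
noncomputable def NE.time : NE → Polynomial ℕ
  | .lit _ => 5
  | .var _ => 5
  | .read _ e => e.time + 10
  | .add e f => e.time + f.time + 10
  | .sub e f => e.time + f.time + 10
  | .cond e f => e.time + f.time + 10
  | .mul e f => e.time + f.time + loopBound 30
  | .sum _ b => loopBound (b.time + 10) + 10
  | .ne0 x => x.time + 10
/-- A bound for the running time of the compiled code, as a polynomial in the range of the sums. -/
noncomputable def RE.time : RE → Polynomial ℕ
  | .read _ e => e.time + 10
  | .add x y => x.time + y.time + 10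
  | .sub x y => x.time + y.time + 10
  | .mul x y => x.time + y.time + 10
  | .cond e x => e.time + x.time + 10
  | .sum _ x => loopBound (x.time + 10) + 10
end

theorem SameBelow.setVar_setVar {k x i : ℕ} {s s₁ : Store}
    (h : SameBelow k (s.setNat 4 x i) s₁) : SameBelow k s (s₁.setNat 4 x (s.nat 4 x)) := by
  refine ⟨fun a ha => ?_, fun j hj => by simpa using h.stack j hj,
    fun a ha => by simpa using h.real a ha, fun j hj => by simpa using h.realStack j hj⟩
  have := h.nat a ha
  by_cases h4 : a = 4
  · subst h4; simp only [setNat_nat, if_true] at this ⊢; rw [this]; simp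
  · simpa [h4] using this

theorem SameBelow.setVar {k x i i' : ℕ} {s s₁ : Store}
    (h : SameBelow k (s.setNat 4 x i') s₁) :
    SameBelow k (s.setNat 4 x i) (s₁.setNat 4 x i) := by
  refine ⟨fun a ha => ?_, fun j hj => by simpa using h.stack j hj,
    fun a ha => by simpa using h.real a ha, fun j hj => by simpa using h.realStack j hj⟩
  have := h.nat a ha
  by_cases h4 : a = 4
  · subst h4; simp only [setNat_nat, if_true] at this ⊢; rw [this]; simp
  · simpa [h4] using this

theorem Represents.setVar {s : Store} {G : Tables} {v : ℕ → ℕ} (h : Represents s G v) (x i : ℕ) :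
    Represents (s.setNat 4 x i) G (Function.update v x i) :=
  ⟨by simp [h.var], fun a => by simp [tableArray_ne_four, h.nat], h.real⟩

theorem Represents.bound_eq {s : Store} {G : Tables} {v : ℕ → ℕ} (h : Represents s G v) :
    s.nat 1 3 = G.bound := by
  rw [Tables.bound, ← h.nat 0]; rfl

/-- The loop of a sum. `J i` is the invariant after `i` rounds; it concerns cell `k` of the stacks. -/
theorem runs_sumLoop {G : Tables} {v : ℕ → ℕ} {k x T : ℕ} {p : Prog} {s : Store}
    (hs : Represents s G v) (J : ℕ → Store → Prop)
    (hJ : ∀ i (s s' : Store), J i s → s'.nat 0 k = s.nat 0 k → s'.real = s.real → J i s')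
    (h0 : J 0 s)
    (hp : ∀ i s', i < G.bound → Represents s' G (Function.update v x i) → J i s' →
      Runs p s' T fun s'' => J (i + 1) s'' ∧ SameBelow k s' s'' ∧
        s''.nat 0 (k + 1) = s'.nat 0 (k + 1) ∧ s''.nat 0 (k + 2) = s'.nat 0 (k + 2)) :
    Runs (sumLoop k x p) s (G.bound * (T + 30) + 30) fun s' => J G.bound s' ∧ SameBelow k s s' := by
  let I : ℕ → Store → Prop := fun i s₁ => J i s₁ ∧ s₁.nat 0 (k + 2) = i ∧ s₁.nat 0 (k + 1) = v x ∧
    ∃ i', SameBelow k (s.setNat 4 x i') s₁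
  have hX : ∀ {i s₁}, I i s₁ → s₁.nat 1 3 = G.bound := by
    rintro i s₁ ⟨-, -, -, i', h⟩
    exact (h.represents (hs.setVar x i')).bound_eq
  have hI0 : I 0 ((s.setNat 0 (k + 1) (v x)).setNat 0 (k + 2) 0) := by
    refine ⟨hJ 0 s _ h0 (by simp) rfl, by simp, by simp, v x, ?_⟩
    have : SameBelow k (s.setNat 4 x (v x)) s := by
      refine ⟨fun a ha => ?_, fun j hj => by simp, fun a ha => rfl, fun j hj => rfl⟩
      by_cases h4 : a = 4
      · subst h4; simp [← hs.var]
      · simp [h4]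
    exact (this.setNat (by omega)).setNat (by omega)
  have hw := Runs.while (b := .natLt (top (k + 2)) boundCell) (T := T + 12)
    (p := .seq (.setNat 4 (.lit x) (top (k + 2))) (.seq p
        (.setNat 0 (.lit (k + 2)) (.add (top (k + 2)) (.lit 1))))) (n := G.bound) I
    (fun i s₁ h _ => by simp [Test.holds, NatExpr.val, h.2.1, hX h]) ?_ hI0
  · refine Runs.mono (T := 4 + (3 + ((G.bound * (5 + (T + 12)) + 5) + 4))) (Q := fun s' => J G.bound s' ∧ SameBelow k s s')
      ?_ (by nlinarith) (fun _ h => h)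
    refine (Runs.setNat (Q := fun s' => s' = s.setNat 0 (k + 1) (v x))
      (by simp [NatExpr.val, hs.var])).seq ?_
    rintro _ rfl
    refine (Runs.setNat (Q := fun s' => s' = (s.setNat 0 (k + 1) (v x)).setNat 0 (k + 2) 0)
      (by simp [NatExpr.val])).seq ?_
    rintro _ rfl
    refine hw.seq ?_
    rintro s' ⟨h₁, h₂, h₃, i', h₄⟩
    refine Runs.setNat ⟨hJ _ _ _ h₁ (by simp) rfl, ?_⟩
    have := h₄.setVar_setVar
    simpa [NatExpr.val, h₃, hs.var] using this
  · rintro i s₁ hi ⟨h₁, h₂, h₃, i', h₄⟩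
    refine Runs.mono (T := 4 + (T + 6)) (Q := I (i + 1)) ?_ (by omega) (fun _ h => h)
    refine (Runs.setNat (Q := fun s' => s' = s₁.setNat 4 x i)
      (by simp [NatExpr.val, h₂])).seq ?_
    rintro _ rfl
    have h₅ := h₄.setVar (i := i)
    refine (hp i (s₁.setNat 4 x i) hi (h₅.represents (hs.setVar x i))
      (hJ _ _ _ h₁ (by simp) rfl)).seq ?_
    rintro s₂ ⟨g₁, g₂, g₃, g₄⟩
    refine Runs.setNat ⟨hJ _ _ _ g₁ (by simp [NatExpr.val]) rfl, ?_, ?_, i, ?_⟩ |>.mono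
      (by simp [NatExpr.cost]) (fun _ h => h)
    · simp [NatExpr.val, g₄, h₂]
    · simp [NatExpr.val, g₃, h₃]
    · exact (h₅.trans g₂ le_rfl).setNat (by simp [NatExpr.val])

/-- The loop of a product. -/
theorem runs_mulLoop {X k : ℕ} {s : Store} (hX : s.nat 1 3 = X) :
    Runs (.seq (.setNat 0 (.lit (k + 2)) (.lit 0)) <| .seq (.setNat 0 (.lit (k + 3)) (.lit 0)) <|
      .seq (.while (.natLt (top (k + 2)) boundCell)
        (.seq (.ite (.natLt (top (k + 2)) (top k))
            (.setNat 0 (.lit (k + 3)) (.add (top (k + 3)) (top (k + 1)))) .skip)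
          (.setNat 0 (.lit (k + 2)) (.add (top (k + 2)) (.lit 1))))) <|
      .setNat 0 (.lit k) (top (k + 3))) s (X * 60 + 30)
      fun s' => s'.nat 0 k = min (s.nat 0 k) X * s.nat 0 (k + 1) ∧ SameBelow k s s' := by
  let I : ℕ → Store → Prop := fun i s₁ => s₁.nat 0 k = s.nat 0 k ∧ s₁.nat 0 (k + 1) = s.nat 0 (k + 1) ∧
    s₁.nat 0 (k + 2) = i ∧ s₁.nat 0 (k + 3) = min (s.nat 0 k) i * s.nat 0 (k + 1) ∧ SameBelow k s s₁
  have hI0 : I 0 ((s.setNat 0 (k + 2) 0).setNat 0 (k + 3) 0) := by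
    refine ⟨by simp, by simp, by simp, by simp, ?_⟩
    exact ((SameBelow.refl k s).setNat (by omega)).setNat (by omega)
  have hw := Runs.while (b := .natLt (top (k + 2)) boundCell) (T := 30)
    (p := .seq (.ite (.natLt (top (k + 2)) (top k))
            (.setNat 0 (.lit (k + 3)) (.add (top (k + 3)) (top (k + 1)))) .skip)
          (.setNat 0 (.lit (k + 2)) (.add (top (k + 2)) (.lit 1)))) (n := X) I
    (fun i s₁ h _ => by
      have := h.2.2.2.2.nat 1 (by decide)
      simp [Test.holds, NatExpr.val, h.2.2.1, this, hX]) ?_ hI0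
  · refine Runs.mono (T := 3 + (3 + ((X * (5 + 30) + 5) + 4))) (Q := fun s' => s'.nat 0 k = min (s.nat 0 k) X * s.nat 0 (k + 1) ∧ SameBelow k s s')
      ?_ (by omega) (fun _ h => h)
    refine (Runs.setNat (Q := fun s' => s' = s.setNat 0 (k + 2) 0)
      (by simp [NatExpr.val])).seq ?_
    rintro _ rfl
    refine (Runs.setNat (Q := fun s' => s' = (s.setNat 0 (k + 2) 0).setNat 0 (k + 3) 0)
      (by simp [NatExpr.val])).seq ?_
    rintro _ rfl
    refine hw.seq ?_
    rintro s' ⟨h₁, h₂, h₃, h₄, h₅⟩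
    exact Runs.setNat ⟨by simp [NatExpr.val, h₄], h₅.setNat (by simp [NatExpr.val])⟩
  · rintro i s₁ hi ⟨h₁, h₂, h₃, h₄, h₅⟩
    refine Runs.mono (T := (5 + 8) + 6) (Q := I (i + 1)) ?_ (by omega) (fun _ h => h)
    refine Runs.seq (Q := fun s' => s'.nat 0 k = s.nat 0 k ∧ s'.nat 0 (k + 1) = s.nat 0 (k + 1) ∧
      s'.nat 0 (k + 2) = i ∧ s'.nat 0 (k + 3) = min (s.nat 0 k) (i + 1) * s.nat 0 (k + 1) ∧
      SameBelow k s s') ?_ ?_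
    · refine Runs.ite (fun hb => ?_) (fun hb => ?_)
      · refine (Runs.setNat ⟨by simp [NatExpr.val, h₁], by simp [NatExpr.val, h₂],
          by simp [NatExpr.val, h₃], ?_, h₅.setNat (by simp [NatExpr.val])⟩).mono
          (by simp [NatExpr.cost]) (fun _ h => h)
        simp only [Test.holds, NatExpr.val, h₃, h₁] at hb
        simp only [NatExpr.val, setNat_nat, if_true, Function.update_self, h₄, h₂]
        rw [min_eq_right (by omega), min_eq_right (by omega), Nat.succ_mul]
      · refine (Runs.skip ⟨h₁, h₂, h₃, ?_, h₅⟩).mono (by omega) (fun _ h => h)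
        simp only [Test.holds, NatExpr.val, h₃, h₁] at hb
        rw [h₄, min_eq_left (by omega), min_eq_left (by omega)]
    · rintro s₂ ⟨g₁, g₂, g₃, g₄, g₅⟩
      refine Runs.setNat ⟨by simp [NatExpr.val, g₁], by simp [NatExpr.val, g₂],
        by simp [NatExpr.val, g₃], by simp [NatExpr.val, g₄],
        g₅.setNat (by simp [NatExpr.val])⟩ |>.mono (by simp [NatExpr.cost]) (fun _ h => h)

mutual
theorem NE.runs_comp (e : NE) : ∀ (G : Tables) (v : ℕ → ℕ) (k : ℕ) (s : Store), Represents s G v →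
    Runs (e.comp k) s (e.time.eval G.bound) fun s' => s'.nat 0 k = e.eval G v ∧ SameBelow k s s' := by
  intro G v k s hs
  match e with
  | .lit n =>
    refine Runs.setNat ⟨by simp [NatExpr.val, NE.eval], (SameBelow.refl k s).setNat le_rfl⟩ |>.mono ?_
      fun _ h => h
    simp [NatExpr.cost, NE.time]
  | .var x =>
    refine Runs.setNat ⟨by simp [NatExpr.val, NE.eval, hs.var], (SameBelow.refl k s).setNat le_rfl⟩
      |>.mono ?_ fun _ h => h
    simp [NatExpr.cost, NE.time]
  | .read a e =>
    refine ((NE.runs_comp e G v k s hs).seq fun s₁ ⟨h₁, h₂⟩ => Runs.setNat ⟨?_, h₂.setNat le_rfl⟩)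
      |>.mono ?_ fun _ h => h
    · simp [NatExpr.cost, NE.time]
    · simp [NatExpr.val, NE.eval, (h₂.represents hs).nat, h₁]
  | .add e f =>
    refine ((NE.runs_comp e G v k s hs).seq fun s₁ ⟨h₁, h₂⟩ =>
      (NE.runs_comp f G v (k + 1) s₁ (h₂.represents hs)).seq fun s₂ ⟨g₁, g₂⟩ =>
      Runs.setNat ⟨?_, (h₂.trans g₂ (by omega)).setNat le_rfl⟩) |>.mono ?_ fun _ h => h
    · simp [NatExpr.cost, NE.time]; omega
    · simp [NatExpr.val, NE.eval, g₁, g₂.stack k (by omega), h₁]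
  | .sub e f =>
    refine ((NE.runs_comp e G v k s hs).seq fun s₁ ⟨h₁, h₂⟩ =>
      (NE.runs_comp f G v (k + 1) s₁ (h₂.represents hs)).seq fun s₂ ⟨g₁, g₂⟩ =>
      Runs.setNat ⟨?_, (h₂.trans g₂ (by omega)).setNat le_rfl⟩) |>.mono ?_ fun _ h => h
    · simp [NatExpr.cost, NE.time]; omega
    · simp [NatExpr.val, NE.eval, g₁, g₂.stack k (by omega), h₁]
  | .cond e f =>
    refine ((NE.runs_comp e G v k s hs).seq (T₂ := 4 + (f.time.eval G.bound + 1))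
      fun s₁ ⟨h₁, h₂⟩ => Runs.ite (fun hb => ?_) (fun hb => ?_)) |>.mono ?_ fun _ h => h
    · refine (NE.runs_comp f G v k s₁ (h₂.represents hs)).mono (by omega) fun s₂ ⟨g₁, g₂⟩ =>
        ⟨?_, h₂.trans g₂ le_rfl⟩
      simp only [Test.holds, NatExpr.val, h₁] at hb
      rw [g₁, NE.eval, if_pos (by omega)]
    · refine (Runs.skip ⟨?_, h₂⟩).mono (by omega) fun _ h => h
      simp only [Test.holds, NatExpr.val, h₁] at hb
      rw [h₁, NE.eval, if_neg (by omega)]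
      omega
    · simp [NE.time]; omega
  | .mul e f =>
    refine ((NE.runs_comp e G v k s hs).seq fun s₁ ⟨h₁, h₂⟩ =>
      (NE.runs_comp f G v (k + 1) s₁ (h₂.represents hs)).seq fun s₂ ⟨g₁, g₂⟩ =>
      (runs_mulLoop (g₂.represents (h₂.represents hs)).bound_eq).mono le_rfl fun s₃ ⟨u₁, u₂⟩ =>
      ⟨?_, (h₂.trans g₂ (by omega)).trans u₂ le_rfl⟩) |>.mono ?_ fun _ h => h
    · simp [NE.time, loopBound]; omega
    · rw [u₁, g₁, g₂.stack k (by omega), h₁, NE.eval]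
  | .sum x b =>
    refine (Runs.setNat (Q := fun s' => s' = s.setNat 0 k 0) (by simp [NatExpr.val])).seq ?_ |>.mono
      (T' := (NE.time (.sum x b)).eval G.bound) (T := 3 + (G.bound * ((b.time + 10).eval G.bound + 30) + 30))
      (by simp [NE.time, loopBound]; omega) fun _ h => h
    rintro _ rfl
    have hk := (SameBelow.refl k s).setNat (j := k) (x := 0) le_rfl
    refine (runs_sumLoop (hk.represents hs)
      (fun i s' => s'.nat 0 k = ∑ i ∈ Finset.range i, b.eval G (Function.update v x i))
      (fun i s s' h h' _ => h'.trans h) (by simp) ?_).mono le_rfl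
      fun s' ⟨h₁, h₂⟩ => ⟨by rw [h₁, NE.eval], hk.trans h₂ le_rfl⟩
    intro i s' hi hs' hJ
    refine (NE.runs_comp b G _ (k + 3) s' hs').seq (fun s₁ ⟨g₁, g₂⟩ => Runs.setNat
      ⟨?_, (SameBelow.trans (k := k) ⟨g₂.nat, fun j hj => g₂.stack j (by omega), g₂.real,
        fun j hj => g₂.realStack j (by omega)⟩ (.refl k _) le_rfl).setNat le_rfl, ?_, ?_⟩)
      |>.mono ?_ fun _ h => h
    · simp [NatExpr.cost]
    · simp [NatExpr.val, g₁, g₂.stack k (by omega), hJ, Finset.sum_range_succ]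
    · simp [NatExpr.val, g₂.stack (k + 1) (by omega)]
    · simp [NatExpr.val, g₂.stack (k + 2) (by omega)]
  | .ne0 x =>
    refine ((RE.runs_comp x G v k s hs).seq (T₂ := 4 + 3)
      fun s₁ ⟨h₁, h₂⟩ => Runs.ite (fun hb => ?_) (fun hb => ?_)) |>.mono ?_ fun _ h => h
    · refine (Runs.setNat ⟨?_, h₂.setNat le_rfl⟩)
      simp only [Test.holds, NatExpr.val, RealExpr.val, h₁] at hb
      simp [NatExpr.val, NE.eval, hb]
    · refine (Runs.setNat ⟨?_, h₂.setNat le_rfl⟩)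
      simp only [Test.holds, NatExpr.val, RealExpr.val, h₁] at hb
      simp [NatExpr.val, NE.eval, hb]
    · simp [NE.time]
theorem RE.runs_comp (e : RE) : ∀ (G : Tables) (v : ℕ → ℕ) (k : ℕ) (s : Store), Represents s G v →
    Runs (e.comp k) s (e.time.eval G.bound) fun s' => s'.real 2 k = e.eval G v ∧ SameBelow k s s' := by
  intro G v k s hs
  match e with
  | .read a e =>
    refine ((NE.runs_comp e G v k s hs).seq fun s₁ ⟨h₁, h₂⟩ => Runs.setReal ⟨?_, h₂.setReal le_rfl⟩)
      |>.mono ?_ fun _ h => h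
    · simp [NatExpr.cost, RealExpr.cost, RE.time]
    · simp [NatExpr.val, RealExpr.val, RE.eval, (h₂.represents hs).real, h₁]
  | .add x y =>
    refine ((RE.runs_comp x G v k s hs).seq fun s₁ ⟨h₁, h₂⟩ =>
      (RE.runs_comp y G v (k + 1) s₁ (h₂.represents hs)).seq fun s₂ ⟨g₁, g₂⟩ =>
      Runs.setReal ⟨?_, (h₂.trans g₂ (by omega)).setReal le_rfl⟩) |>.mono ?_ fun _ h => h
    · simp [NatExpr.cost, RealExpr.cost, RE.time]; omega
    · simp [NatExpr.val, RealExpr.val, RE.eval, g₁, g₂.realStack k (by omega), h₁]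
  | .sub x y =>
    refine ((RE.runs_comp x G v k s hs).seq fun s₁ ⟨h₁, h₂⟩ =>
      (RE.runs_comp y G v (k + 1) s₁ (h₂.represents hs)).seq fun s₂ ⟨g₁, g₂⟩ =>
      Runs.setReal ⟨?_, (h₂.trans g₂ (by omega)).setReal le_rfl⟩) |>.mono ?_ fun _ h => h
    · simp [NatExpr.cost, RealExpr.cost, RE.time]; omega
    · simp [NatExpr.val, RealExpr.val, RE.eval, g₁, g₂.realStack k (by omega), h₁]
  | .mul x y =>
    refine ((RE.runs_comp x G v k s hs).seq fun s₁ ⟨h₁, h₂⟩ =>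
      (RE.runs_comp y G v (k + 1) s₁ (h₂.represents hs)).seq fun s₂ ⟨g₁, g₂⟩ =>
      Runs.setReal ⟨?_, (h₂.trans g₂ (by omega)).setReal le_rfl⟩) |>.mono ?_ fun _ h => h
    · simp [NatExpr.cost, RealExpr.cost, RE.time]; omega
    · simp [NatExpr.val, RealExpr.val, RE.eval, g₁, g₂.realStack k (by omega), h₁]
  | .cond e x =>
    refine ((NE.runs_comp e G v k s hs).seq (T₂ := 4 + (x.time.eval G.bound + 3))
      fun s₁ ⟨h₁, h₂⟩ => Runs.ite (fun hb => ?_) (fun hb => ?_)) |>.mono ?_ fun _ h => h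
    · refine (RE.runs_comp x G v k s₁ (h₂.represents hs)).mono (by omega) fun s₂ ⟨g₁, g₂⟩ =>
        ⟨?_, h₂.trans g₂ le_rfl⟩
      simp only [Test.holds, NatExpr.val, h₁] at hb
      rw [g₁, RE.eval, if_pos (by omega)]
    · refine (Runs.setReal ⟨?_, h₂.setReal le_rfl⟩).mono
        (by simp [NatExpr.cost, RealExpr.cost]) fun _ h => h
      simp only [Test.holds, NatExpr.val, h₁] at hb
      rw [RE.eval, if_neg (by omega)]
      simp [NatExpr.val, RealExpr.val]
    · simp [RE.time]; omega
  | .sum z x =>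
    refine (Runs.setReal (Q := fun s' => s' = s.setReal 2 k 0) (by simp [NatExpr.val, RealExpr.val])).seq ?_ |>.mono
      (T' := (RE.time (.sum z x)).eval G.bound) (T := 3 + (G.bound * ((x.time + 10).eval G.bound + 30) + 30))
      (by simp [RE.time, loopBound]; omega) fun _ h => h
    rintro _ rfl
    have hk := (SameBelow.refl k s).setReal (j := k) (x := 0) le_rfl
    refine (runs_sumLoop (hk.represents hs)
      (fun i s' => s'.real 2 k = ∑ i ∈ Finset.range i, x.eval G (Function.update v z i))
      (fun i s s' h _ h' => (congrFun (congrFun h' 2) k).trans h) (by simp) ?_).mono le_rfl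
      fun s' ⟨h₁, h₂⟩ => ⟨by rw [h₁, RE.eval], hk.trans h₂ le_rfl⟩
    intro i s' hi hs' hJ
    refine (RE.runs_comp x G _ (k + 3) s' hs').seq (fun s₁ ⟨g₁, g₂⟩ => Runs.setReal
      ⟨?_, (SameBelow.trans (k := k) ⟨g₂.nat, fun j hj => g₂.stack j (by omega), g₂.real,
        fun j hj => g₂.realStack j (by omega)⟩ (.refl k _) le_rfl).setReal le_rfl, ?_, ?_⟩)
      |>.mono ?_ fun _ h => h
    · simp [NatExpr.cost, RealExpr.cost]
    · simp [NatExpr.val, RealExpr.val, g₁, g₂.realStack k (by omega), hJ, Finset.sum_range_succ]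
    · simp [g₂.stack (k + 1) (by omega)]
    · simp [g₂.stack (k + 2) (by omega)]
end

end RealRAM

/-! ### Positive semidefinite matrices -/

namespace Matrix

variable {n : Type*} [Fintype n]

open scoped MatrixOrder in
theorem PosSemidef.exists_eq_conjTranspose_mul_self [DecidableEq n] {A : Matrix n n ℂ} (hA : A.PosSemidef) :
    ∃ C : Matrix n n ℂ, A = Cᴴ * C :=
  CStarAlgebra.nonneg_iff_eq_star_mul_self.mp hA.nonneg

theorem PosSemidef.trace_mul_nonneg [DecidableEq n] {A B : Matrix n n ℂ} (hA : A.PosSemidef) (hB : B.PosSemidef) :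
    0 ≤ (A * B).trace := by
  obtain ⟨C, rfl⟩ := hB.exists_eq_conjTranspose_mul_self
  rw [← Matrix.mul_assoc, trace_mul_comm, ← Matrix.mul_assoc]
  exact (hA.mul_mul_conjTranspose_same C).trace_nonneg

theorem PosSemidef.mul_eq_zero_of_conj [DecidableEq n] {A D : Matrix n n ℂ} (hA : A.PosSemidef)
    (h : Dᴴ * A * D = 0) : A * D = 0 := by
  obtain ⟨C, rfl⟩ := hA.exists_eq_conjTranspose_mul_self
  have : (C * D)ᴴ * (C * D) = 0 := by
    rw [conjTranspose_mul, ← h]; simp only [Matrix.mul_assoc]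
  rw [Matrix.mul_assoc, conjTranspose_mul_self_eq_zero.1 this, Matrix.mul_zero]

theorem eq_zero_of_sum_posSemidef {ι : Type*} [Fintype ι] {A : ι → Matrix n n ℂ}
    (hA : ∀ i, (A i).PosSemidef) (h : ∑ i, A i = 0) (i : ι) : A i = 0 := by
  rw [← (hA i).trace_eq_zero_iff]
  have : ∑ i, (A i).trace = 0 := by rw [← trace_sum, h, trace_zero]
  exact (Finset.sum_eq_zero_iff_of_nonneg fun i _ => (hA i).trace_nonneg).1 this i (Finset.mem_univ i)

theorem PosDef.exists_pos_sub_posSemidef [DecidableEq n] {D : Matrix n n ℂ} (hD : D.PosDef) :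
    ∃ ε : ℝ, 0 < ε ∧ (D - (ε : ℂ) • 1).PosSemidef := by
  have hH := hD.isHermitian
  have hpos : ∀ i, 0 < hH.eigenvalues i := hD.eigenvalues_pos
  obtain ⟨ε, hε, hle⟩ : ∃ ε : ℝ, 0 < ε ∧ ∀ i, ε ≤ hH.eigenvalues i := by
    rcases isEmpty_or_nonempty n with h | h
    · exact ⟨1, one_pos, fun i => (h.false i).elim⟩
    · obtain ⟨i, hi⟩ := Finite.exists_min hH.eigenvalues
      exact ⟨_, hpos i, hi⟩
  refine ⟨ε, hε, ?_⟩
  have hU : (hH.eigenvectorUnitary : Matrix n n ℂ) * (star hH.eigenvectorUnitary : Matrix n n ℂ) = 1 :=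
    Unitary.coe_mul_star_self _
  have : D - (ε : ℂ) • 1 = (hH.eigenvectorUnitary : Matrix n n ℂ) *
      diagonal (fun i => ((hH.eigenvalues i - ε : ℝ) : ℂ)) *
      (hH.eigenvectorUnitary : Matrix n n ℂ)ᴴ := by
    have hd : diagonal (fun i => ((hH.eigenvalues i - ε : ℝ) : ℂ)) =
        diagonal (RCLike.ofReal ∘ hH.eigenvalues) - (ε : ℂ) • (1 : Matrix n n ℂ) := by
      ext i j; by_cases hij : i = j <;> simp [hij]
    conv_lhs => rw [hH.spectral_theorem, Unitary.conjStarAlgAut_apply]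
    rw [hd, Matrix.mul_sub, Matrix.sub_mul, Matrix.mul_smul, Matrix.smul_mul, Matrix.mul_one,
      ← star_eq_conjTranspose, hU]
  rw [this]
  refine PosSemidef.mul_mul_conjTranspose_same (PosSemidef.diagonal fun i => ?_) _
  simpa using hle i

theorem posDef_of_posSemidef_of_mulVec_ne {D : Matrix n n ℂ} (hD : D.PosSemidef)
    (h : ∀ v, D *ᵥ v = 0 → v = 0) : D.PosDef := by
  refine .of_dotProduct_mulVec_pos hD.isHermitian fun v hv => ?_
  refine lt_of_le_of_ne (hD.dotProduct_mulVec_nonneg v) fun h0 => hv (h v ?_)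
  exact (hD.dotProduct_mulVec_zero_iff v).1 h0.symm

/-- A left factor that fixes a nonzero product `A * C` with `A` of rank one fixes `A`. -/
theorem mul_eq_self_of_rankOne {A K C : Matrix n n ℂ} {φ η : n → ℂ} (hA : A = vecMulVec φ η)
    (h0 : A * C ≠ 0) (h : K * (A * C) = A * C) : K * A = A := by
  subst hA
  rw [vecMulVec_mul] at h h0
  rw [mul_vecMulVec] at h ⊢
  have hu : ∃ j, (η ᵥ* C) j ≠ 0 := by
    by_contra! hu
    exact h0 (by ext i j; simp [vecMulVec_apply, hu])
  obtain ⟨j, hj⟩ := hu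
  congr 1
  ext i
  have := congrFun (congrFun h i) j
  simp only [vecMulVec_apply] at this
  exact mul_right_cancel₀ hj this

/-- Conjugation by a rank-one matrix has a one-dimensional range. -/
theorem conj_eq_smul_of_rankOne {A : Matrix n n ℂ} {φ η : n → ℂ} (hA : A = vecMulVec φ η)
    (τ : Matrix n n ℂ) : ∃ c : ℂ, A * τ * Aᴴ = c • (A * Aᴴ) := by
  subst hA
  by_cases hη : η = 0
  · subst hη; exact ⟨0, by simp⟩
  · have h0 : η ⬝ᵥ star η ≠ 0 := by simpa [dotProduct_self_star_eq_zero] using hη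
    refine ⟨((η ᵥ* τ) ⬝ᵥ star η) / (η ⬝ᵥ star η), ?_⟩
    ext i j
    simp only [vecMulVec_mul, conjTranspose_vecMulVec, vecMul_vecMulVec, smul_apply,
      vecMulVec_apply, smul_eq_mul, Pi.smul_apply]
    field_simp

end Matrix

namespace QMDP

/-! ### Weighted states and the dual evolution -/

/-- The event observed when operator `k` of the choice `x` acts. -/
def ev (M : QMDP) : (x : M.Choice) → Fin (M.fam x).len → M.Event
  | Sum.inl α, _ => Sum.inl α
  | Sum.inr β, k => Sum.inr ⟨β, k⟩

@[simp] theorem choiceOf_ev (M : QMDP) (x : M.Choice) (k : Fin (M.fam x).len) :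
    M.choiceOf (M.ev x k) = x := by cases x <;> rfl

/-- The operators of a choice. -/
def kraus (M : QMDP) (x : M.Choice) (k : Fin (M.fam x).len) : Matrix (Fin M.dim) (Fin M.dim) ℂ :=
  (M.fam x).op k

theorem sum_kraus (M : QMDP) (x : M.Choice) : ∑ k, (M.kraus x k)ᴴ * M.kraus x k = 1 :=
  (M.fam x).complete

/-- All operators have rank at most one. -/
def RankOneKraus (M : QMDP) : Prop :=
  ∀ x k, ∃ φ η : Fin M.dim → ℂ, M.kraus x k = vecMulVec φ η

/-- The state `p_w ρ_w`. -/
noncomputable def wstate (M : QMDP) (S : M.Scheduler) (ρ : Matrix (Fin M.dim) (Fin M.dim) ℂ)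
    (w : List M.Event) : Matrix (Fin M.dim) (Fin M.dim) ℂ :=
  ((M.config S ρ w).2 : ℂ) • (M.config S ρ w).1

theorem config_posSemidef (M : QMDP) (S : M.Scheduler) {ρ : Matrix (Fin M.dim) (Fin M.dim) ℂ}
    (hρ : ρ.PosSemidef) (w : List M.Event) : (M.config S ρ w).1.PosSemidef ∧ 0 ≤ (M.config S ρ w).2 := by
  induction w with
  | nil => exact ⟨hρ, zero_le_one⟩
  | cons e w ih =>
    match e with
    | Sum.inl α =>
      rw [config]
      split_ifs
      · exact ⟨posSemidef_sum _ fun i _ => ih.1.mul_mul_conjTranspose_same _, ih.2⟩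
      · exact ⟨.zero, le_rfl⟩
    | Sum.inr ⟨β, j⟩ =>
      rw [config]
      split_ifs
      · have h := ih.1.mul_mul_conjTranspose_same ((M.meas β).op j)
        have ht := h.trace_nonneg
        exact ⟨h.smul (by simpa using ht), mul_nonneg ih.2 (Complex.nonneg_iff.1 ht).1⟩
      · exact ⟨.zero, le_rfl⟩

theorem wstate_posSemidef (M : QMDP) (S : M.Scheduler) {ρ : Matrix (Fin M.dim) (Fin M.dim) ℂ}
    (hρ : ρ.PosSemidef) (w : List M.Event) : (M.wstate S ρ w).PosSemidef :=
  (M.config_posSemidef S hρ w).1.smul (by simpa using (M.config_posSemidef S hρ w).2)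

theorem wstate_nil (M : QMDP) (S : M.Scheduler) (ρ : Matrix (Fin M.dim) (Fin M.dim) ℂ) :
    M.wstate S ρ [] = ρ := by simp [wstate, config]

theorem wstate_cons (M : QMDP) (S : M.Scheduler) {ρ : Matrix (Fin M.dim) (Fin M.dim) ℂ}
    (hρ : ρ.PosSemidef) (e : M.Event) (w : List M.Event) :
    M.wstate S ρ (e :: w) = ∑ k, if M.ev (S w) k = e then
      M.kraus (S w) k * M.wstate S ρ w * (M.kraus (S w) k)ᴴ else 0 := by
  generalize hx : S w = x
  match e, x, hx with
  | Sum.inl α, Sum.inl α', hx =>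
    by_cases h : α' = α
    · subst h
      simp [wstate, config, hx, ev, OpFamily.superOp, kraus, fam, Finset.smul_sum]
      rfl
    · simp [wstate, config, hx, ev, h]
  | Sum.inl α, Sum.inr β, hx => simp [wstate, config, hx, ev]
  | Sum.inr ⟨β, j⟩, Sum.inl α, hx => simp [wstate, config, hx, ev]
  | Sum.inr ⟨β, j⟩, Sum.inr β', hx =>
    by_cases h : β' = β
    · subst h
      have h := (M.config_posSemidef S hρ w).1.mul_mul_conjTranspose_same ((M.meas β').op j)
      simp only [wstate, config, hx, ev, kraus, fam, if_true, Sum.inr.injEq, Sigma.mk.injEq,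
        heq_eq_eq, true_and, Finset.sum_ite_eq']
      set σ := (M.meas β').op j * (M.config S ρ w).1 * ((M.meas β').op j)ᴴ with hσ
      rw [Matrix.mul_smul, Matrix.smul_mul, ← hσ, smul_smul]
      refine Eq.trans ?_ (if_pos (Finset.mem_univ j)).symm
      by_cases h0 : σ.trace = 0
      · rw [h.trace_eq_zero_iff.1 h0]; simp
      · congr 1
        have : ((σ.trace.re : ℝ) : ℂ) = σ.trace := by
          have := (Complex.nonneg_iff.1 h.trace_nonneg).2
          exact Complex.ext (by simp) (by simp [← this])
        push_cast
        rw [this, mul_assoc, mul_inv_cancel₀ h0, mul_one]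
    · have : ∀ k : Fin (M.fam (Sum.inr β')).len, ¬ (M.ev (Sum.inr β') k = Sum.inr ⟨β, j⟩) := by
        intro k hk
        simp only [ev, Sum.inr.injEq] at hk
        exact h (congrArg Sigma.fst hk)
      simp [wstate, config, hx, h, this]

theorem wstate_of_not_consistent (M : QMDP) (S : M.Scheduler)
    {ρ : Matrix (Fin M.dim) (Fin M.dim) ℂ} (hρ : ρ.PosSemidef) (w : List M.Event)
    (h : ¬ M.Consistent S w) : M.wstate S ρ w = 0 := by
  induction w with
  | nil => exact (h trivial).elim
  | cons e w ih =>
    rw [wstate_cons _ _ hρ]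
    refine Finset.sum_eq_zero fun k _ => ?_
    split_ifs with hk
    · have : ¬ M.Consistent S w := fun hw => h ⟨by rw [← hk, choiceOf_ev], hw⟩
      rw [ih this]; simp
    · rfl

/-- The dual evolution: the observable `Z`, measured after `n` more steps, as an observable of the
state after the history `w`. -/
noncomputable def dual (M : QMDP) (S : M.Scheduler) (Z : Matrix (Fin M.dim) (Fin M.dim) ℂ) :
    ℕ → List M.Event → Matrix (Fin M.dim) (Fin M.dim) ℂ
  | 0, _ => Z
  | n + 1, w => ∑ k, (M.kraus (S w) k)ᴴ * M.dual S Z n (M.ev (S w) k :: w) * M.kraus (S w) k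

/-- The expectation of `Z` after `m + n` steps, the last `n` of them in the dual picture. -/
noncomputable def expect (M : QMDP) (S : M.Scheduler) (ρ Z : Matrix (Fin M.dim) (Fin M.dim) ℂ)
    (m n : ℕ) : ℂ :=
  ∑ w : Fin m → M.Event, (M.dual S Z n (List.ofFn w) * M.wstate S ρ (List.ofFn w)).trace

theorem expect_succ (M : QMDP) (S : M.Scheduler) {ρ : Matrix (Fin M.dim) (Fin M.dim) ℂ}
    (hρ : ρ.PosSemidef) (Z : Matrix (Fin M.dim) (Fin M.dim) ℂ) (m n : ℕ) :
    M.expect S ρ Z (m + 1) n = M.expect S ρ Z m (n + 1) := by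
  classical
  rw [expect, ← (Fin.consEquiv fun _ => M.Event).sum_comp, Fintype.sum_prod_type_right, expect]
  refine Finset.sum_congr rfl fun w _ => ?_
  have hw : ∀ e : M.Event, List.ofFn ((Fin.consEquiv fun _ => M.Event) (e, w)) = e :: List.ofFn w :=
    fun e => List.ofFn_cons e w
  simp only [hw, dual]
  generalize List.ofFn w = l
  simp only [wstate_cons _ _ hρ, Finset.mul_sum, trace_sum, Finset.sum_mul, mul_ite, mul_zero]
  rw [Finset.sum_comm]
  refine Finset.sum_congr rfl fun k _ => ?_
  rw [Finset.sum_eq_single (M.ev (S l) k) (fun e _ he => by rw [if_neg (Ne.symm he), trace_zero])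
    (fun h => (h (Finset.mem_univ _)).elim), if_pos rfl]
  rw [← Matrix.mul_assoc, ← Matrix.mul_assoc, trace_mul_comm]
  simp only [Matrix.mul_assoc]

theorem expect_add (M : QMDP) (S : M.Scheduler) {ρ : Matrix (Fin M.dim) (Fin M.dim) ℂ}
    (hρ : ρ.PosSemidef) (Z : Matrix (Fin M.dim) (Fin M.dim) ℂ) (m n : ℕ) :
    M.expect S ρ Z (m + n) 0 = M.expect S ρ Z m n := by
  suffices ∀ n j, M.expect S ρ Z (m + n) j = M.expect S ρ Z m (n + j) from this n 0
  intro n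
  induction n with
  | zero => simp
  | succ n ih => intro j; rw [← add_assoc, expect_succ _ _ hρ, ih, add_right_comm n 1 j, add_assoc]

theorem dual_one (M : QMDP) (S : M.Scheduler) (n : ℕ) (w : List M.Event) : M.dual S 1 n w = 1 := by
  induction n generalizing w with
  | zero => rfl
  | succ n ih => simp [dual, ih, sum_kraus]

theorem expect_one (M : QMDP) (S : M.Scheduler) {ρ : Matrix (Fin M.dim) (Fin M.dim) ℂ}
    (hρ : IsDensity ρ) (m : ℕ) : M.expect S ρ 1 m 0 = 1 := by
  have := M.expect_add S hρ.1 1 0 m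
  rw [zero_add] at this
  rw [this, expect]
  simp [dual_one, wstate_nil, hρ.2]

theorem probAt_eq (M : QMDP) (S : M.Scheduler) (ρ : Matrix (Fin M.dim) (Fin M.dim) ℂ)
    (B : Submodule ℂ (EuclideanSpace ℂ (Fin M.dim))) (n : ℕ) :
    M.probAt S ρ B n = (M.expect S ρ (projMatrix B) n 0).re := by
  simp only [probAt, globalState, Finset.mul_sum, trace_sum, expect, dual, wstate]

theorem expect_sub (M : QMDP) (S : M.Scheduler) (ρ Z Z' : Matrix (Fin M.dim) (Fin M.dim) ℂ) (m : ℕ) :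
    M.expect S ρ (Z - Z') m 0 = M.expect S ρ Z m 0 - M.expect S ρ Z' m 0 := by
  simp only [expect, dual, Matrix.sub_mul, trace_sub, Finset.sum_sub_distrib]

/-! ### The projection onto an invariant subspace -/

theorem toEuclideanLin_projMatrix {d : ℕ} (B : Submodule ℂ (EuclideanSpace ℂ (Fin d)))
    (v : EuclideanSpace ℂ (Fin d)) : toEuclideanLin (projMatrix B) v = B.starProjection v := by
  simp [projMatrix]

theorem projMatrix_mul_self {d : ℕ} (B : Submodule ℂ (EuclideanSpace ℂ (Fin d))) :
    projMatrix B * projMatrix B = projMatrix B := by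
  apply toEuclideanLin.injective
  ext1 v
  have : toEuclideanLin (projMatrix B * projMatrix B) v =
      toEuclideanLin (projMatrix B) (toEuclideanLin (projMatrix B) v) := by
    simp [toLpLin_apply]
  rw [this]
  simp only [toEuclideanLin_projMatrix]
  exact Submodule.starProjection_eq_self_iff.2 (Submodule.starProjection_apply_mem B v)

theorem projMatrix_isHermitian {d : ℕ} (B : Submodule ℂ (EuclideanSpace ℂ (Fin d))) :
    (projMatrix B).IsHermitian := by
  rw [← isSymmetric_toEuclideanLin_iff, projMatrix]
  simpa using Submodule.starProjection_isSymmetric B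

theorem supp_le_iff {d : ℕ} (B : Submodule ℂ (EuclideanSpace ℂ (Fin d)))
    (ρ : Matrix (Fin d) (Fin d) ℂ) : supp ρ ≤ B ↔ projMatrix B * ρ = ρ := by
  have h : ∀ v, toEuclideanLin (projMatrix B * ρ) v = B.starProjection (toEuclideanLin ρ v) := by
    intro v
    rw [← toEuclideanLin_projMatrix]
    simp [toLpLin_apply]
  rw [supp, LinearMap.range_le_iff_comap, eq_top_iff]
  constructor
  · intro H
    apply toEuclideanLin.injective
    ext1 v
    rw [h]
    exact Submodule.starProjection_eq_self_iff.2 (H (Submodule.mem_top (x := v)))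
  · intro H v _
    have h' : B.starProjection (toEuclideanLin ρ v) = toEuclideanLin ρ v := by rw [← h v, H]
    rw [Submodule.mem_comap]
    exact Submodule.starProjection_eq_self_iff.1 h'

theorem one_sub_projMatrix_posSemidef {d : ℕ} (B : Submodule ℂ (EuclideanSpace ℂ (Fin d))) :
    (1 - projMatrix B).PosSemidef := by
  have h : 1 - projMatrix B = (1 - projMatrix B)ᴴ * (1 - projMatrix B) := by
    rw [conjTranspose_sub, conjTranspose_one, (projMatrix_isHermitian B).eq, Matrix.mul_sub,
      Matrix.sub_mul, Matrix.sub_mul, projMatrix_mul_self]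
    simp
  rw [h]
  exact posSemidef_conjTranspose_mul_self _

theorem projMatrix_posSemidef {d : ℕ} (B : Submodule ℂ (EuclideanSpace ℂ (Fin d))) :
    (projMatrix B).PosSemidef := by
  have h : projMatrix B = (projMatrix B)ᴴ * projMatrix B := by
    rw [(projMatrix_isHermitian B).eq, projMatrix_mul_self]
  rw [h]
  exact posSemidef_conjTranspose_mul_self _

end QMDP

namespace QMDP

theorem one_sub_proj_mul_mul_proj_of_sum {d : ℕ} {ι : Type*} [Fintype ι]
    (B : Submodule ℂ (EuclideanSpace ℂ (Fin d))) (A : ι → Matrix (Fin d) (Fin d) ℂ)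
    (h : ∀ ρ, IsDensity ρ → supp ρ ≤ B → supp (∑ i, A i * ρ * (A i)ᴴ) ≤ B) (i : ι) :
    (1 - projMatrix B) * A i * projMatrix B = 0 := by
  set P := projMatrix B with hP
  have hH : Pᴴ = P := projMatrix_isHermitian B
  have hPP : P * P = P := projMatrix_mul_self B
  by_cases h0 : P = 0
  · simp [h0]
  have ht : P.trace ≠ 0 := fun ht => h0 ((projMatrix_posSemidef B).trace_eq_zero_iff.1 ht)
  have hd : IsDensity (P.trace⁻¹ • P) := by
    refine ⟨(projMatrix_posSemidef B).smul ?_, by simp [ht]⟩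
    simpa using (projMatrix_posSemidef B).trace_nonneg
  have h1 := h _ hd (by rw [supp_le_iff, ← hP, Matrix.mul_smul, hPP])
  rw [supp_le_iff, ← hP] at h1
  have h2 : P.trace⁻¹ • ∑ i, (P * (A i * P * (A i)ᴴ)) = P.trace⁻¹ • ∑ i, (A i * P * (A i)ᴴ) := by
    simpa [Finset.mul_sum, Finset.smul_sum] using h1
  have h3 := smul_right_injective (Matrix (Fin d) (Fin d) ℂ) (inv_ne_zero ht) h2
  have h4 : ∑ i, ((1 - P) * A i * P) * ((1 - P) * A i * P)ᴴ = 0 := by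
    have : ∀ i, ((1 - P) * A i * P) * ((1 - P) * A i * P)ᴴ =
        ((A i * P * (A i)ᴴ) - (P * (A i * P * (A i)ᴴ))) * (1 - P) := by
      intro i
      have e : (1 - P) * A i * P * ((1 - P) * A i * P)ᴴ =
          (1 - P) * A i * (P * P) * (A i)ᴴ * (1 - P) := by
        simp only [conjTranspose_mul, conjTranspose_sub, conjTranspose_one, hH, Matrix.mul_assoc]
      rw [e, hPP]
      simp only [Matrix.sub_mul, Matrix.one_mul, Matrix.mul_assoc]
    simp only [this]
    rw [← Finset.sum_mul, Finset.sum_sub_distrib, h3, sub_self, Matrix.zero_mul]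
  exact self_mul_conjTranspose_eq_zero.1
    (eq_zero_of_sum_posSemidef (fun i => posSemidef_self_mul_conjTranspose _) h4 i)

theorem Invariant.proj_mul {M : QMDP} {B : Submodule ℂ (EuclideanSpace ℂ (Fin M.dim))}
    (h : M.Invariant B) (x : M.Choice) (k : Fin (M.fam x).len) :
    (1 - projMatrix B) * M.kraus x k * (1 - projMatrix B) = (1 - projMatrix B) * M.kraus x k := by
  have : (1 - projMatrix B) * M.kraus x k * projMatrix B = 0 := by
    match x, k with
    | Sum.inl α, k => exact one_sub_proj_mul_mul_proj_of_sum B (M.act α).op (h.1 α) k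
    | Sum.inr β, k =>
      exact one_sub_proj_mul_mul_proj_of_sum (ι := Unit) B (fun _ => (M.meas β).op k)
        (by simpa using h.2 β k) ()
  rw [Matrix.mul_sub, this, Matrix.mul_one, sub_zero]

/-! ### Histories that avoid the subspace surely -/

/-- The operators of `y` that may act on a state produced by one of the operators `T` of `x`. -/
def next (M : QMDP) (x : M.Choice) (T : Set (Fin (M.fam x).len)) (y : M.Choice) :
    Set (Fin (M.fam y).len) :=
  {k | ∃ i ∈ T, M.kraus y k * M.kraus x i ≠ 0}

/-- After choice `x`, with the operators in `T` possible, `n` more choices can be made such that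
the subspace is avoided with certainty by all states but the last. -/
def CanAvoid (M : QMDP) (B : Submodule ℂ (EuclideanSpace ℂ (Fin M.dim))) :
    ℕ → (x : M.Choice) → Set (Fin (M.fam x).len) → Prop
  | 0, _, _ => True
  | n + 1, x, T => (∀ i ∈ T, projMatrix B * M.kraus x i = 0) ∧ ∃ y ∈ M.avail x, ∀ k,
      M.CanAvoid B n y {k' | k' ∈ M.next x T y ∧ M.ev y k' = M.ev y k}

theorem CanAvoid.anti {M : QMDP} {B : Submodule ℂ (EuclideanSpace ℂ (Fin M.dim))} {n : ℕ}
    {x : M.Choice} {T T' : Set (Fin (M.fam x).len)} (h : M.CanAvoid B n x T') (hT : T ⊆ T') :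
    M.CanAvoid B n x T := by
  induction n generalizing x with
  | zero => trivial
  | succ n ih =>
    obtain ⟨h1, y, hy, h2⟩ := h
    refine ⟨fun i hi => h1 i (hT hi), y, hy, fun k => ih (h2 k) ?_⟩
    rintro k' ⟨⟨i, hi, hne⟩, hk⟩
    exact ⟨⟨i, hT hi, hne⟩, hk⟩

theorem CanAvoid.of_succ {M : QMDP} {B : Submodule ℂ (EuclideanSpace ℂ (Fin M.dim))} {n : ℕ}
    {x : M.Choice} {T : Set (Fin (M.fam x).len)} (h : M.CanAvoid B (n + 1) x T) :
    M.CanAvoid B n x T := by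
  induction n generalizing x with
  | zero => trivial
  | succ n ih =>
    obtain ⟨h1, y, hy, h2⟩ := h
    exact ⟨h1, y, hy, fun k => ih (h2 k)⟩

theorem CanAvoid.mono {M : QMDP} {B : Submodule ℂ (EuclideanSpace ℂ (Fin M.dim))} {m n : ℕ}
    {x : M.Choice} {T : Set (Fin (M.fam x).len)} (h : M.CanAvoid B n x T) (hmn : m ≤ n) :
    M.CanAvoid B m x T := by
  induction n, hmn using Nat.le_induction with
  | base => exact h
  | succ n _ ih => exact ih h.of_succ

/-- A choice that keeps an everlasting possibility to avoid the subspace. -/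
theorem exists_avail_forall_canAvoid {M : QMDP} {B : Submodule ℂ (EuclideanSpace ℂ (Fin M.dim))}
    {x : M.Choice} {T : Set (Fin (M.fam x).len)} (h : ∀ n, M.CanAvoid B n x T) :
    ∃ y ∈ M.avail x, ∀ k n, M.CanAvoid B n y {k' | k' ∈ M.next x T y ∧ M.ev y k' = M.ev y k} := by
  by_contra! hc
  choose! k n hkn using hc
  obtain ⟨-, y, hy, h2⟩ := h ((M.avail x).sup n + 1)
  exact hkn y hy ((h2 (k y hy)).mono (Finset.le_sup hy))

/-- A node: the last choice, and the set of its operators that may have acted. -/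
abbrev Node (M : QMDP) : Type := Σ x : M.Choice, Set (Fin (M.fam x).len)

open Classical in
/-- A choice that keeps an everlasting possibility to avoid the subspace, if there is one. -/
noncomputable def avoidingChoice (M : QMDP) (B : Submodule ℂ (EuclideanSpace ℂ (Fin M.dim)))
    (ν : M.Node) : M.Choice :=
  if h : ∀ n, M.CanAvoid B n ν.1 ν.2 then (exists_avail_forall_canAvoid h).choose else ν.1

/-- The node reached by an event after a node. -/
def nodeStep (M : QMDP) (ν : M.Node) (e : M.Event) : M.Node :=
  ⟨M.choiceOf e, {k | k ∈ M.next ν.1 ν.2 (M.choiceOf e) ∧ M.ev (M.choiceOf e) k = e}⟩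

/-- The node reached by a history. -/
def nodeAfter (M : QMDP) (ν : M.Node) : List M.Event → M.Node
  | [] => ν
  | e :: w => M.nodeStep (M.nodeAfter ν w) e

theorem exists_ev_eq (M : QMDP) (e : M.Event) (hd : 0 < (M.fam (M.choiceOf e)).len) :
    ∃ k, M.ev (M.choiceOf e) k = e := by
  match e with
  | Sum.inl α => exact ⟨⟨0, hd⟩, rfl⟩
  | Sum.inr ⟨β, j⟩ => exact ⟨j, rfl⟩

theorem len_pos (M : QMDP) (x : M.Choice) (hd : 0 < M.dim) : 0 < (M.fam x).len := by
  by_contra h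
  have h0 : (M.fam x).len = 0 := by omega
  have h1 := M.sum_kraus x
  have : IsEmpty (Fin (M.fam x).len) := by rw [h0]; infer_instance
  rw [Finset.univ_eq_empty, Finset.sum_empty] at h1
  have := congrFun (congrFun h1 ⟨0, hd⟩) ⟨0, hd⟩
  simp at this

/-- If the subspace can be avoided forever from a possible state, it is not always reached. -/
theorem not_alwaysReaches_of_canAvoid {M : QMDP} {B : Submodule ℂ (EuclideanSpace ℂ (Fin M.dim))}
    (hR : M.RankOneKraus) {x : M.Choice} {i : Fin (M.fam x).len} (hne : M.kraus x i ≠ 0)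
    (h : ∀ n, M.CanAvoid B n x {i}) : ¬ M.AlwaysReaches B := by
  have hd : 0 < M.dim := by
    by_contra h0
    have : IsEmpty (Fin M.dim) := by rw [show M.dim = 0 by omega]; infer_instance
    exact hne (by ext a; exact this.elim a)
  let node := M.nodeAfter ⟨x, {i}⟩
  let S : M.Scheduler := fun w => M.avoidingChoice B (node w)
  have hspec : ∀ ν : M.Node, (∀ n, M.CanAvoid B n ν.1 ν.2) → M.avoidingChoice B ν ∈ M.avail ν.1 ∧
      ∀ k n, M.CanAvoid B n (M.avoidingChoice B ν) {k' | k' ∈ M.next ν.1 ν.2 (M.avoidingChoice B ν) ∧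
        M.ev (M.avoidingChoice B ν) k' = M.ev (M.avoidingChoice B ν) k} := by
    intro ν hν
    rw [avoidingChoice, dif_pos hν]
    exact (exists_avail_forall_canAvoid hν).choose_spec
  have hnode : ∀ w, M.Consistent S w → ∀ n, M.CanAvoid B n (node w).1 (node w).2 := by
    intro w
    induction w with
    | nil => exact fun _ => h
    | cons e w ih =>
      rintro ⟨hS, hw⟩ n
      obtain ⟨-, h2⟩ := hspec _ (ih hw)
      change ∀ k n, M.CanAvoid B n (S w) {k' | k' ∈ M.next _ _ (S w) ∧ M.ev (S w) k' = M.ev (S w) k} at h2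
      rw [hS] at h2
      obtain ⟨k, hk⟩ := M.exists_ev_eq e (M.len_pos _ hd)
      have := h2 k n
      rw [hk] at this
      exact this
  have hadm : M.Admissible S := by
    intro e w hw
    exact (hspec _ (hnode _ hw)).1
  have htr : (M.kraus x i * (M.kraus x i)ᴴ).trace ≠ 0 := by
    rwa [Ne, trace_mul_conjTranspose_self_eq_zero_iff]
  set t := (M.kraus x i * (M.kraus x i)ᴴ).trace with ht
  have hpsd := posSemidef_self_mul_conjTranspose (M.kraus x i)
  have hρ : IsDensity (t⁻¹ • (M.kraus x i * (M.kraus x i)ᴴ)) := by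
    refine ⟨hpsd.smul ?_, by rw [trace_smul, ← ht, smul_eq_mul, inv_mul_cancel₀ htr]⟩
    simpa using hpsd.trace_nonneg
  set ρ := t⁻¹ • (M.kraus x i * (M.kraus x i)ᴴ) with hρdef
  let V : M.Node → Submodule ℂ (Matrix (Fin M.dim) (Fin M.dim) ℂ) := fun ν =>
    Submodule.span ℂ ((fun j => M.kraus ν.1 j * (M.kraus ν.1 j)ᴴ) '' ν.2)
  have hV : ∀ w, M.Consistent S w → M.wstate S ρ w ∈ V (node w) := by
    intro w
    induction w with
    | nil =>
      intro _
      rw [wstate_nil]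
      exact Submodule.smul_mem _ _ (Submodule.subset_span ⟨i, rfl, rfl⟩)
    | cons e w ih =>
      rintro ⟨hS, hw⟩
      rw [wstate_cons _ _ hρ.1, hS]
      refine Submodule.sum_mem _ fun k _ => ?_
      split_ifs with hk
      · by_cases hkn : k ∈ M.next (node w).1 (node w).2 (M.choiceOf e)
        · obtain ⟨φ, η, hA⟩ := hR (M.choiceOf e) k
          obtain ⟨c, hc⟩ := conj_eq_smul_of_rankOne hA (M.wstate S ρ w)
          rw [hc]
          exact Submodule.smul_mem _ _ (Submodule.subset_span ⟨k, ⟨hkn, hk⟩, rfl⟩)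
        · have : M.kraus (M.choiceOf e) k * M.wstate S ρ w = 0 := by
            refine Submodule.span_induction (p := fun σ _ => M.kraus (M.choiceOf e) k * σ = 0)
              ?_ (Matrix.mul_zero _) ?_ ?_ (ih hw)
            · rintro _ ⟨j, hj, rfl⟩
              by_contra hne
              refine hkn ⟨j, hj, fun h0 => hne ?_⟩
              change M.kraus (M.choiceOf e) k * (M.kraus _ j * (M.kraus _ j)ᴴ) = 0
              rw [← Matrix.mul_assoc, h0, Matrix.zero_mul]
            · intro a b _ _ ha hb
              rw [Matrix.mul_add, ha, hb, add_zero]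
            · intro c a _ ha
              rw [Matrix.mul_smul, ha, smul_zero]
          rw [this, Matrix.zero_mul]
          exact Submodule.zero_mem _
      · exact Submodule.zero_mem _
  have hP : ∀ w, projMatrix B * M.wstate S ρ w = 0 := by
    intro w
    by_cases hw : M.Consistent S w
    · have hok := (hnode w hw 1).1
      refine Submodule.span_induction (p := fun σ _ => projMatrix B * σ = 0)
        ?_ (Matrix.mul_zero _) ?_ ?_ (hV w hw)
      · rintro _ ⟨j, hj, rfl⟩
        change projMatrix B * (M.kraus _ j * (M.kraus _ j)ᴴ) = 0
        rw [← Matrix.mul_assoc, hok j hj, Matrix.zero_mul]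
      · intro a b _ _ ha hb
        rw [Matrix.mul_add, ha, hb, add_zero]
      · intro c a _ ha
        rw [Matrix.mul_smul, ha, smul_zero]
    · rw [wstate_of_not_consistent _ _ hρ.1 _ hw, Matrix.mul_zero]
  intro hall
  have hlim := hall S hadm ρ hρ
  have h0 : M.probAt S ρ B = fun _ => 0 := by
    ext n
    rw [probAt_eq, expect]
    simp [dual, hP]
  rw [HasReachProb, h0] at hlim
  exact zero_ne_one (tendsto_nhds_unique tendsto_const_nhds hlim)

/-! ### Almost sure reachability -/

/-- The observables after choice `y`, given the possible observables after the next event. -/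
def dualStep (M : QMDP) (y : M.Choice) (𝒦 : Set (Matrix (Fin M.dim) (Fin M.dim) ℂ)) :
    Set (Matrix (Fin M.dim) (Fin M.dim) ℂ) :=
  {K | ∃ f : M.Event → Matrix (Fin M.dim) (Fin M.dim) ℂ, (∀ k, f (M.ev y k) ∈ 𝒦) ∧
    K = ∑ k, (M.kraus y k)ᴴ * f (M.ev y k) * M.kraus y k}

/-- The possible dual evolutions, in `n` steps, of the projection onto the orthogonal complement of
the subspace. -/
def dualSet (M : QMDP) (B : Submodule ℂ (EuclideanSpace ℂ (Fin M.dim))) :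
    ℕ → M.Choice → Set (Matrix (Fin M.dim) (Fin M.dim) ℂ)
  | 0, _ => {1 - projMatrix B}
  | n + 1, x => ⋃ y ∈ M.avail x, M.dualStep y (M.dualSet B n y)

theorem dualStep_finite (M : QMDP) (y : M.Choice) {𝒦 : Set (Matrix (Fin M.dim) (Fin M.dim) ℂ)}
    (h : 𝒦.Finite) : (M.dualStep y 𝒦).Finite := by
  have hf : (Set.univ.pi fun _ : Fin (M.fam y).len => 𝒦).Finite := Set.Finite.pi fun _ => h
  refine (hf.image fun g => ∑ k, (M.kraus y k)ᴴ * g k * M.kraus y k).subset ?_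
  rintro K ⟨f, hfk, rfl⟩
  exact ⟨fun k => f (M.ev y k), fun k _ => hfk k, rfl⟩

theorem dualSet_finite (M : QMDP) (B : Submodule ℂ (EuclideanSpace ℂ (Fin M.dim))) (n : ℕ)
    (x : M.Choice) : (M.dualSet B n x).Finite := by
  induction n generalizing x with
  | zero => exact Set.finite_singleton _
  | succ n ih => exact Set.Finite.biUnion (Finset.finite_toSet _) fun y _ => M.dualStep_finite y (ih y)

theorem dual_mem_dualSet {M : QMDP} (B : Submodule ℂ (EuclideanSpace ℂ (Fin M.dim)))
    {S : M.Scheduler} (hS : M.Admissible S) (n : ℕ) (e : M.Event) (w : List M.Event)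
    (hw : M.Consistent S (e :: w)) :
    M.dual S (1 - projMatrix B) n (e :: w) ∈ M.dualSet B n (M.choiceOf e) := by
  induction n generalizing e w with
  | zero => rfl
  | succ n ih =>
    refine Set.mem_biUnion (hS e w hw) ⟨fun e' => M.dual S (1 - projMatrix B) n (e' :: e :: w), ?_, rfl⟩
    intro k
    have := ih (M.ev (S (e :: w)) k) (e :: w) ⟨by rw [choiceOf_ev], hw⟩
    rwa [choiceOf_ev] at this

theorem dual_mem_dualStep {M : QMDP} (B : Submodule ℂ (EuclideanSpace ℂ (Fin M.dim)))
    {S : M.Scheduler} (hS : M.Admissible S) (n : ℕ) (w : List M.Event) (hw : M.Consistent S w) :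
    M.dual S (1 - projMatrix B) (n + 1) w ∈ M.dualStep (S w) (M.dualSet B n (S w)) := by
  refine ⟨fun e' => M.dual S (1 - projMatrix B) n (e' :: w), fun k => ?_, rfl⟩
  have := dual_mem_dualSet B hS n (M.ev (S w) k) w ⟨by rw [choiceOf_ev], hw⟩
  rwa [choiceOf_ev] at this

/-- Observables between `0` and `1` that vanish on the subspace. -/
structure IsEffect {d : ℕ} (B : Submodule ℂ (EuclideanSpace ℂ (Fin d)))
    (K : Matrix (Fin d) (Fin d) ℂ) : Prop where
  posSemidef : K.PosSemidef
  one_sub : (1 - K).PosSemidef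
  mul_proj : K * (1 - projMatrix B) = K

theorem one_sub_sum_kraus (M : QMDP) (y : M.Choice)
    (f : Fin (M.fam y).len → Matrix (Fin M.dim) (Fin M.dim) ℂ) :
    1 - ∑ k, (M.kraus y k)ᴴ * f k * M.kraus y k =
      ∑ k, (M.kraus y k)ᴴ * (1 - f k) * M.kraus y k := by
  simp only [Matrix.mul_sub, Matrix.sub_mul, Matrix.mul_one, Finset.sum_sub_distrib, sum_kraus]

theorem IsEffect.dualStep {M : QMDP} {B : Submodule ℂ (EuclideanSpace ℂ (Fin M.dim))}
    (hB : M.Invariant B) {y : M.Choice} {𝒦 : Set (Matrix (Fin M.dim) (Fin M.dim) ℂ)}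
    (h : ∀ K ∈ 𝒦, IsEffect B K) : ∀ K ∈ M.dualStep y 𝒦, IsEffect B K := by
  rintro K ⟨f, hf, rfl⟩
  refine ⟨posSemidef_sum _ fun k _ => (h _ (hf k)).posSemidef.conjTranspose_mul_mul_same _, ?_, ?_⟩
  · rw [one_sub_sum_kraus M y fun k => f (M.ev y k)]
    exact posSemidef_sum _ fun k _ => (h _ (hf k)).one_sub.conjTranspose_mul_mul_same _
  · rw [Finset.sum_mul]
    refine Finset.sum_congr rfl fun k _ => ?_
    have h1 := (h _ (hf k)).mul_proj
    have h2 := hB.proj_mul y k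
    generalize f (M.ev y k) = F at *
    calc (M.kraus y k)ᴴ * F * M.kraus y k * (1 - projMatrix B)
        = (M.kraus y k)ᴴ * (F * (1 - projMatrix B)) * M.kraus y k * (1 - projMatrix B) := by rw [h1]
      _ = (M.kraus y k)ᴴ * F * ((1 - projMatrix B) * M.kraus y k * (1 - projMatrix B)) := by
          simp only [Matrix.mul_assoc]
      _ = (M.kraus y k)ᴴ * (F * (1 - projMatrix B)) * M.kraus y k := by
          rw [h2]; simp only [Matrix.mul_assoc]
      _ = _ := by rw [h1]

theorem one_sub_projMatrix_mul_self {d : ℕ} (B : Submodule ℂ (EuclideanSpace ℂ (Fin d))) :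
    (1 - projMatrix B) * (1 - projMatrix B) = 1 - projMatrix B := by
  rw [Matrix.mul_sub, Matrix.sub_mul, Matrix.sub_mul, projMatrix_mul_self]
  simp

theorem IsEffect.dualSet {M : QMDP} {B : Submodule ℂ (EuclideanSpace ℂ (Fin M.dim))}
    (hB : M.Invariant B) (n : ℕ) (x : M.Choice) : ∀ K ∈ M.dualSet B n x, IsEffect B K := by
  induction n generalizing x with
  | zero =>
    rintro _ rfl
    refine ⟨one_sub_projMatrix_posSemidef B, ?_, one_sub_projMatrix_mul_self B⟩
    simpa using projMatrix_posSemidef B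
  | succ n ih =>
    intro K hK
    obtain ⟨y, -, hK⟩ := Set.mem_iUnion₂.1 hK
    exact IsEffect.dualStep hB (ih y) K hK

theorem fixed_of_sum_fixed (M : QMDP) (y : M.Choice)
    (f : Fin (M.fam y).len → Matrix (Fin M.dim) (Fin M.dim) ℂ) (hf : ∀ k, (1 - f k).PosSemidef)
    {C : Matrix (Fin M.dim) (Fin M.dim) ℂ}
    (hC : (∑ k, (M.kraus y k)ᴴ * f k * M.kraus y k) * C = C) (k : Fin (M.fam y).len) :
    f k * (M.kraus y k * C) = M.kraus y k * C := by
  have h : ∑ k, (M.kraus y k * C)ᴴ * (1 - f k) * (M.kraus y k * C) = 0 := by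
    have h1 : (1 - ∑ k, (M.kraus y k)ᴴ * f k * M.kraus y k) * C = 0 := by
      rw [Matrix.sub_mul, hC, Matrix.one_mul, sub_self]
    rw [one_sub_sum_kraus] at h1
    have h2 : Cᴴ * ((∑ k, (M.kraus y k)ᴴ * (1 - f k) * M.kraus y k) * C) = 0 := by
      rw [h1, Matrix.mul_zero]
    rw [Finset.sum_mul, Finset.mul_sum] at h2
    rw [← h2]
    refine Finset.sum_congr rfl fun k _ => ?_
    simp only [conjTranspose_mul, Matrix.mul_assoc]
  have := (hf k).mul_eq_zero_of_conj
    (eq_zero_of_sum_posSemidef (fun k => (hf k).conjTranspose_mul_mul_same _) h k)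
  rw [Matrix.sub_mul, Matrix.one_mul, sub_eq_zero] at this
  exact this.symm

/-- If a possible observable takes the value one on all the states `T`, these can avoid the
subspace. -/
theorem canAvoid_of_fixed {M : QMDP} {B : Submodule ℂ (EuclideanSpace ℂ (Fin M.dim))}
    (hB : M.Invariant B) (hR : M.RankOneKraus) {n : ℕ} {x : M.Choice}
    {K : Matrix (Fin M.dim) (Fin M.dim) ℂ} (hK : K ∈ M.dualSet B n x)
    {T : Set (Fin (M.fam x).len)} (hT : ∀ i ∈ T, K * M.kraus x i = M.kraus x i) :
    M.CanAvoid B n x T := by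
  induction n generalizing x K with
  | zero => trivial
  | succ n ih =>
    have heff := IsEffect.dualSet hB _ _ K hK
    have hK' : (1 - projMatrix B) * K = K := by
      have := congrArg conjTranspose heff.mul_proj
      rwa [conjTranspose_mul, heff.posSemidef.isHermitian.eq,
        (one_sub_projMatrix_posSemidef B).isHermitian.eq] at this
    refine ⟨fun i hi => ?_, ?_⟩
    · have h1 : (1 - projMatrix B) * M.kraus x i = M.kraus x i := by
        rw [← hT i hi, ← Matrix.mul_assoc, hK']
      rw [Matrix.sub_mul, Matrix.one_mul] at h1
      exact sub_eq_self.1 h1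
    · obtain ⟨y, hy, f, hf, rfl⟩ := Set.mem_iUnion₂.1 hK
      refine ⟨y, hy, fun k => ih (hf k) ?_⟩
      rintro k' ⟨⟨i, hi, hne⟩, hev⟩
      have h1 := fixed_of_sum_fixed M y (fun k => f (M.ev y k))
        (fun k => (IsEffect.dualSet hB _ _ _ (hf k)).one_sub) (hT i hi) k'
      obtain ⟨φ, η, hA⟩ := hR y k'
      rw [← hev]
      exact mul_eq_self_of_rankOne hA hne h1

theorem exists_uniform_contraction {d : ℕ} {𝒦 : Set (Matrix (Fin d) (Fin d) ℂ)} (hfin : 𝒦.Finite)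
    (h : ∀ K ∈ 𝒦, (1 - K).PosDef) :
    ∃ ε : ℝ, 0 < ε ∧ ∀ K ∈ 𝒦, (1 - K - (ε : ℂ) • 1).PosSemidef := by
  induction 𝒦, hfin using Set.Finite.induction_on with
  | empty => exact ⟨1, one_pos, by simp⟩
  | @insert K s _ _ ih =>
    obtain ⟨ε, hε, h1⟩ := ih fun K hK => h K (Set.mem_insert_of_mem _ hK)
    obtain ⟨δ, hδ, h2⟩ := (h K (Set.mem_insert _ _)).exists_pos_sub_posSemidef
    have key : ∀ (L : Matrix (Fin d) (Fin d) ℂ) (a b : ℝ), a ≤ b → (L - (b : ℂ) • 1).PosSemidef →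
        (L - (a : ℂ) • 1).PosSemidef := by
      intro L a b hab hL
      have : L - (a : ℂ) • 1 = (L - (b : ℂ) • 1) + ((b - a : ℝ) : ℂ) • 1 := by
        rw [Complex.ofReal_sub, sub_smul]; abel
      rw [this]
      exact hL.add (PosSemidef.one.smul (by simpa using hab))
    refine ⟨min ε δ, lt_min hε hδ, ?_⟩
    rintro L (rfl | hL)
    · exact key _ _ _ (min_le_right _ _) h2
    · exact key _ _ _ (min_le_left _ _) (h1 L hL)

theorem conj_one_sub_sub_smul {d : ℕ} {Q K : Matrix (Fin d) (Fin d) ℂ} (hQ : Q * Q = Q)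
    (h1 : Q * K = K) (h2 : K * Q = K) (δ : ℝ) :
    Q * (1 - K - (δ : ℂ) • 1) * Q = ((1 - δ : ℝ) : ℂ) • Q - K := by
  rw [Matrix.mul_sub, Matrix.mul_sub, Matrix.sub_mul, Matrix.sub_mul, h1, h2, Matrix.mul_one, hQ,
    Matrix.mul_smul, Matrix.smul_mul, Matrix.mul_one, hQ, Complex.ofReal_sub, sub_smul,
    Complex.ofReal_one, one_smul]
  abel

theorem alwaysReaches_of_not_canAvoid {M : QMDP} {B : Submodule ℂ (EuclideanSpace ℂ (Fin M.dim))}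
    (hB : M.Invariant B) (hR : M.RankOneKraus)
    (h : ∀ x i, M.kraus x i ≠ 0 → ∃ n, ¬ M.CanAvoid B n x {i}) : M.AlwaysReaches B := by
  intro S hS ρ hρ
  obtain ⟨n, hn⟩ : ∃ n, ∀ x i, M.kraus x i ≠ 0 → ¬ M.CanAvoid B n x {i} := by
    choose! m hm using h
    refine ⟨Finset.univ.sup fun x => Finset.univ.sup (m x), fun x i hne hc => hm x i hne (hc.mono ?_)⟩
    exact (Finset.le_sup (f := m x) (Finset.mem_univ i)).trans
      (Finset.le_sup (f := fun x => Finset.univ.sup (m x)) (Finset.mem_univ x))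
  set Q := 1 - projMatrix B with hQ
  let 𝒦 := ⋃ y, M.dualStep y (M.dualSet B n y)
  have hfin : 𝒦.Finite := Set.finite_iUnion fun y => M.dualStep_finite y (M.dualSet_finite B n y)
  have hstep : ∀ m y, ∀ K ∈ M.dualStep y (M.dualSet B m y), IsEffect B K := fun m y =>
    IsEffect.dualStep hB (IsEffect.dualSet hB m y)
  have hpd : ∀ K ∈ 𝒦, (1 - K).PosDef := by
    intro K hK
    obtain ⟨y, hK⟩ := Set.mem_iUnion.1 hK
    refine posDef_of_posSemidef_of_mulVec_ne (hstep n y K hK).one_sub fun v hv => ?_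
    obtain ⟨f, hf, rfl⟩ := hK
    by_contra hv0
    have hfix := fixed_of_sum_fixed M y (fun k => f (M.ev y k))
      (fun k => (IsEffect.dualSet hB _ _ _ (hf k)).one_sub) (C := vecMulVec v (star v)) (by
        rw [sub_mulVec, one_mulVec, sub_eq_zero] at hv
        rw [mul_vecMulVec, ← hv])
    have hzero : ∀ k, M.kraus y k * vecMulVec v (star v) = 0 := by
      intro k
      by_contra hk
      obtain ⟨φ, η, hA⟩ := hR y k
      refine hn y k (fun h0 => hk (by rw [h0, Matrix.zero_mul])) (canAvoid_of_fixed hB hR (hf k) ?_)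
      rintro _ rfl
      exact mul_eq_self_of_rankOne hA hk (hfix _)
    have hvv : vecMulVec v (star v) = 0 := by
      rw [← Matrix.one_mul (vecMulVec v (star v)), ← M.sum_kraus y, Finset.sum_mul]
      exact Finset.sum_eq_zero fun k _ => by rw [Matrix.mul_assoc, hzero, Matrix.mul_zero]
    have := congrArg trace hvv
    rw [trace_vecMulVec, trace_zero, dotProduct_self_star_eq_zero] at this
    exact hv0 this
  obtain ⟨ε, hε, hc⟩ := exists_uniform_contraction hfin hpd
  have hQQ : Q * Q = Q := one_sub_projMatrix_mul_self B
  have hQH : Qᴴ = Q := (one_sub_projMatrix_posSemidef B).isHermitian.eq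
  have hpsd := fun w => M.wstate_posSemidef S hρ.1 w
  let r : ℕ → ℝ := fun m => (M.expect S ρ Q m 0).re
  have hcmp : ∀ (K : Matrix (Fin M.dim) (Fin M.dim) ℂ) (δ : ℝ) (σ : Matrix (Fin M.dim) (Fin M.dim) ℂ),
      IsEffect B K → (1 - K - (δ : ℂ) • 1).PosSemidef → σ.PosSemidef →
      (K * σ).trace.re ≤ (1 - δ) * (Q * σ).trace.re := by
    intro K δ σ hK hKδ hσ
    have h1 : Q * K = K := by
      have := congrArg conjTranspose hK.mul_proj
      rwa [conjTranspose_mul, hK.posSemidef.isHermitian.eq, hQH] at this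
    have h2 : Qᴴ * (1 - K - (δ : ℂ) • 1) * Q = ((1 - δ : ℝ) : ℂ) • Q - K := by
      rw [hQH, conj_one_sub_sub_smul hQQ h1 hK.mul_proj]
    have h3 := (hKδ.conjTranspose_mul_mul_same Q).trace_mul_nonneg hσ
    rw [h2, Matrix.sub_mul, trace_sub, Matrix.smul_mul, trace_smul] at h3
    have h4 := (Complex.nonneg_iff.1 h3).1
    rw [Complex.sub_re, smul_eq_mul, Complex.re_ofReal_mul] at h4
    linarith
  have hstepr : ∀ (l : ℕ) (δ : ℝ), (∀ y, ∀ K ∈ M.dualStep y (M.dualSet B l y),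
      (1 - K - (δ : ℂ) • 1).PosSemidef) → ∀ m, r (m + (l + 1)) ≤ (1 - δ) * r m := by
    intro l δ hδ m
    simp only [r]
    rw [M.expect_add S hρ.1, expect, expect, Complex.re_sum, Complex.re_sum, Finset.mul_sum]
    refine Finset.sum_le_sum fun w _ => ?_
    by_cases hw : M.Consistent S (List.ofFn w)
    · have hmem := dual_mem_dualStep B hS l _ hw
      exact hcmp _ _ _ (hstep l _ _ hmem) (hδ _ _ hmem) (hpsd _)
    · rw [wstate_of_not_consistent _ _ hρ.1 _ hw]
      simp
  have hanti : Antitone r := by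
    refine antitone_nat_of_succ_le fun m => ?_
    have := hstepr 0 0 (fun y K hK => by simpa using (hstep 0 y K hK).one_sub) m
    simpa using this
  have hcontr : ∀ m, r (m + (n + 1)) ≤ (1 - ε) * r m :=
    hstepr n ε fun y K hK => hc K (Set.mem_iUnion.2 ⟨y, hK⟩)
  have hnonneg : ∀ m, 0 ≤ r m := by
    intro m
    simp only [r, expect, Complex.re_sum]
    exact Finset.sum_nonneg fun w _ => (Complex.nonneg_iff.1
      ((one_sub_projMatrix_posSemidef B).trace_mul_nonneg (hpsd _))).1
  have hlim := tendsto_atTop_ciInf hanti ⟨0, by rintro _ ⟨m, rfl⟩; exact hnonneg m⟩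
  have hle : (⨅ m, r m) ≤ (1 - ε) * ⨅ m, r m :=
    le_of_tendsto_of_tendsto' ((tendsto_add_atTop_iff_nat (n + 1)).2 hlim) (hlim.const_mul _) hcontr
  have hge : 0 ≤ ⨅ m, r m := le_ciInf hnonneg
  have hz : (⨅ m, r m) = 0 := by nlinarith
  rw [hz] at hlim
  have hprob : M.probAt S ρ B = fun m => 1 - r m := by
    ext m
    rw [probAt_eq]
    simp only [r, hQ]
    rw [expect_sub, expect_one M S hρ]
    simp
  rw [HasReachProb, hprob]
  simpa using hlim.const_sub 1

/-- The subspace is always reached unless it can be avoided forever from a possible state. -/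
theorem alwaysReaches_iff {M : QMDP} {B : Submodule ℂ (EuclideanSpace ℂ (Fin M.dim))}
    (hB : M.Invariant B) (hR : M.RankOneKraus) :
    M.AlwaysReaches B ↔ ¬ ∃ x i, M.kraus x i ≠ 0 ∧ ∀ n, M.CanAvoid B n x {i} := by
  constructor
  · rintro h ⟨x, i, hne, hc⟩
    exact not_alwaysReaches_of_canAvoid hR hne hc h
  · intro h
    refine alwaysReaches_of_not_canAvoid hB hR fun x i hne => ?_
    by_contra! hc
    exact h ⟨x, i, hne, hc⟩

end QMDP

namespace RealRAM

/-! ### Formulas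

An expression is regarded as a formula, true if the value is not zero. -/

/-- The formula is true. -/
def NE.Holds (G : Tables) (v : ℕ → ℕ) (e : NE) : Prop := e.eval G v ≠ 0

namespace NE

def lt (e f : NE) : NE := .sub f e
def not (e : NE) : NE := .sub (.lit 1) e
def eq (e f : NE) : NE := .cond (not (lt e f)) (not (lt f e))
def imp (e f : NE) : NE := .add (not e) f
/-- Bounded existential quantification over variable `z`. -/
def ex (z : ℕ) (b e : NE) : NE := .sum z (.cond (lt (.var z) b) e)
/-- Bounded universal quantification over variable `z`. -/
def all (z : ℕ) (b e : NE) : NE := not (ex z b (not e))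

variable {G : Tables} {v : ℕ → ℕ} {e f b : NE} {z : ℕ}

@[simp] theorem holds_lt : (lt e f).Holds G v ↔ e.eval G v < f.eval G v := by
  simp only [Holds, lt, eval]; omega

@[simp] theorem holds_not : (not e).Holds G v ↔ ¬ e.Holds G v := by
  simp only [Holds, not, eval]; omega

@[simp] theorem holds_cond : (cond e f).Holds G v ↔ e.Holds G v ∧ f.Holds G v := by
  simp [Holds, eval]

@[simp] theorem holds_add : (add e f).Holds G v ↔ e.Holds G v ∨ f.Holds G v := by
  simp only [Holds, eval]; omega

@[simp] theorem holds_eq : (eq e f).Holds G v ↔ e.eval G v = f.eval G v := by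
  simp only [eq, holds_cond, holds_not, holds_lt]; omega

@[simp] theorem holds_imp : (imp e f).Holds G v ↔ (e.Holds G v → f.Holds G v) := by
  simp only [imp, holds_add, holds_not]; tauto

@[simp] theorem holds_read {a : ℕ} : (read a e).Holds G v ↔ G.nat a (e.eval G v) ≠ 0 := by
  simp only [Holds, eval]

@[simp] theorem holds_ne0 {x : RE} : (ne0 x).Holds G v ↔ x.eval G v ≠ 0 := by
  simp [Holds, eval]

@[simp] theorem holds_sum : (sum z e).Holds G v ↔ ∃ i < G.bound, e.Holds G (Function.update v z i) := by
  simp [Holds, eval, Finset.sum_eq_zero_iff]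

theorem holds_ex {n : ℕ} (hn : n ≤ G.bound) (hb : ∀ i, b.eval G (Function.update v z i) = n) :
    (ex z b e).Holds G v ↔ ∃ i < n, e.Holds G (Function.update v z i) := by
  simp only [ex, holds_sum, holds_cond, holds_lt, hb, eval, Function.update_self]
  exact ⟨fun ⟨i, _, hi, h⟩ => ⟨i, hi, h⟩, fun ⟨i, hi, h⟩ => ⟨i, by omega, hi, h⟩⟩

theorem holds_all {n : ℕ} (hn : n ≤ G.bound) (hb : ∀ i, b.eval G (Function.update v z i) = n) :
    (all z b e).Holds G v ↔ ∀ i < n, e.Holds G (Function.update v z i) := by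
  simp only [all, holds_not, holds_ex hn hb]
  push Not
  rfl

theorem eval_mul_of_le (h : e.eval G v ≤ G.bound) :
    (mul e f).eval G v = e.eval G v * f.eval G v := by
  rw [eval, min_eq_left h]

end NE

end RealRAM

namespace QMDP

open RealRAM

/-- The position of a choice in the list of all choices. -/
def code (M : QMDP) (x : M.Choice) : ℕ := (finSumFinEquiv x : Fin (M.numAct + M.numMeas))

theorem code_lt (M : QMDP) (x : M.Choice) : M.code x < M.numAct + M.numMeas := (finSumFinEquiv x).2

theorem code_inj {M : QMDP} {x y : M.Choice} : M.code x = M.code y ↔ x = y := by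
  rw [code, code, Fin.val_inj, finSumFinEquiv.apply_eq_iff_eq]

theorem exists_code_iff (M : QMDP) {p : ℕ → Prop} :
    (∃ i < M.numAct + M.numMeas, p i) ↔ ∃ x, p (M.code x) := by
  refine ⟨fun ⟨i, hi, h⟩ => ⟨finSumFinEquiv.symm ⟨i, hi⟩, by simpa [code] using h⟩,
    fun ⟨x, h⟩ => ⟨_, M.code_lt x, h⟩⟩

theorem ev_eq_ev_iff (M : QMDP) (x : M.Choice) (k k' : Fin (M.fam x).len) :
    M.ev x k' = M.ev x k ↔ M.code x < M.numAct ∨ k = k' := by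
  match x with
  | Sum.inl α => simp [ev, code]
  | Sum.inr β =>
    have : ¬ M.code (Sum.inr β) < M.numAct := by simp [code]
    simp only [ev, Sum.inr.injEq, this, false_or]
    exact ⟨fun h => (eq_of_heq (Sigma.mk.inj h).2).symm, fun h => by rw [h]⟩

/-- The tables hold the input, the range of the sums, and the powers of two. Table `3` is free. -/
structure IsInput (M : QMDP) (B : Submodule ℂ (EuclideanSpace ℂ (Fin M.dim))) (G : Tables) : Prop where
  bound : G.nat 0 3 = (M.numAct + M.numMeas) * 2 ^ M.maxLen
  dim : G.nat 0 0 = M.dim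
  numAct : G.nat 0 1 = M.numAct
  numMeas : G.nat 0 2 = M.numMeas
  twoPow : G.nat 0 4 = 2 ^ M.maxLen
  len : ∀ x, G.nat 1 (M.code x) = (M.fam x).len
  avail : ∀ x y, G.nat 2 ((M.numAct + M.numMeas) * M.code x + M.code y) ≠ 0 ↔ y ∈ M.avail x
  pow : ∀ i < M.maxLen, G.nat 4 i = 2 ^ i
  proj_re : ∀ r c, G.real false (2 * (M.dim * r.1 + c.1)) = (projMatrix B r c).re
  proj_im : ∀ r c, G.real false (2 * (M.dim * r.1 + c.1) + 1) = (projMatrix B r c).im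
  op_re : ∀ x (k : Fin (M.fam x).len) (r c : Fin M.dim), G.real true (2 * (M.dim * (M.dim *
    (∑ z ∈ Finset.range (M.code x), G.nat 1 z + k.1) + r.1) + c.1)) = (M.kraus x k r c).re
  op_im : ∀ x (k : Fin (M.fam x).len) (r c : Fin M.dim), G.real true (2 * (M.dim * (M.dim *
    (∑ z ∈ Finset.range (M.code x), G.nat 1 z + k.1) + r.1) + c.1) + 1) = (M.kraus x k r c).im
  dim_le : M.Choice → M.dim ≤ G.nat 0 3

theorem len_le_maxLen (M : QMDP) (x : M.Choice) : (M.fam x).len ≤ M.maxLen :=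
  Finset.le_sup (f := fun x => (M.fam x).len) (Finset.mem_univ x)

namespace IsInput

variable {M : QMDP} {B : Submodule ℂ (EuclideanSpace ℂ (Fin M.dim))} {G : Tables}

theorem numChoices_le (h : M.IsInput B G) : M.numAct + M.numMeas ≤ G.bound := by
  rw [Tables.bound, h.bound]
  exact Nat.le_mul_of_pos_right _ (by positivity)

theorem twoPow_le (h : M.IsInput B G) (x : M.Choice) : 2 ^ M.maxLen ≤ G.bound := by
  rw [Tables.bound, h.bound]
  exact Nat.le_mul_of_pos_left _ (by have := M.code_lt x; omega)

theorem len_le (h : M.IsInput B G) (x : M.Choice) : (M.fam x).len ≤ G.bound :=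
  (M.len_le_maxLen x).trans (Nat.lt_two_pow_self.le.trans (h.twoPow_le x))

end IsInput

/-! ### The formulas of the algorithm -/

namespace Alg

def dimE : NE := .read 0 (.lit 0)
def actE : NE := .read 0 (.lit 1)
def numE : NE := .add (.read 0 (.lit 1)) (.read 0 (.lit 2))
def powE : NE := .read 0 (.lit 4)
def dbl (e : NE) : NE := .add e e
/-- The number of operators of the choice `x`. -/
def lenE (x : ℕ) : NE := .read 1 (.var x)
/-- The position, among all operators, of operator `i` of the choice `x`. -/
def opE (x i : ℕ) : NE := .add (.sum 20 (.cond (.lt (.var 20) (.var x)) (lenE 20))) (.var i)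
/-- Real (`q = 0`) or imaginary (`q = 1`) part of an entry of operator number `o`. -/
def entryE (o : NE) (r c q : ℕ) : RE :=
  .read true (.add (dbl (.add (.mul dimE (.add (.mul dimE o) (.var r))) (.var c))) (.lit q))
/-- Real or imaginary part of an entry of the projection. -/
def projE (r c q : ℕ) : RE := .read false (.add (dbl (.add (.mul dimE (.var r)) (.var c))) (.lit q))
/-- The matrix with the given entries is not zero. -/
def matNe (L : ℕ → ℕ → ℕ → RE) : NE :=
  .ex 8 dimE (.ex 9 dimE (.add (.ne0 (L 8 9 0)) (.ne0 (L 8 9 1))))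
/-- The product of two matrices. -/
def prodE (L R : ℕ → ℕ → ℕ → RE) (r c q : ℕ) : RE :=
  .sum 10 (.cond (.lt (.var 10) dimE)
    (if q = 0 then .sub (.mul (L r 10 0) (R 10 c 0)) (.mul (L r 10 1) (R 10 c 1))
      else .add (.mul (L r 10 0) (R 10 c 1)) (.mul (L r 10 1) (R 10 c 0))))
/-- Bit `i` of `c` is set. -/
def bitE (c i : ℕ) : NE :=
  .sum 11 (.sum 12 (.cond (.lt (.var 12) (.read 4 (.var i)))
    (.eq (.var c) (.add (.mul (.read 4 (.var i)) (.add (dbl (.var 11)) (.lit 1))) (.var 12)))))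
/-- All states with code `c` of choice `x` are orthogonal to the subspace. -/
def safeE (x c : ℕ) : NE :=
  .all 6 (lenE x) (.imp (bitE c 6) (.not (matNe (prodE projE (entryE (opE x 6))))))
/-- Operator `k` of `y` may act after a state with code `c` of choice `x`. -/
def nextE (x c y k : ℕ) : NE :=
  .ex 7 (lenE x) (.cond (bitE c 7) (matNe (prodE (entryE (opE y k)) (entryE (opE x 7)))))
/-- The entry of table `3` for choice `x` and code `c`. -/
def lossE (x c : ℕ) : NE := .read 3 (.add (.mul powE (.var x)) (.var c))
/-- Choice `0` with code `1` can avoid the subspace for one more step. -/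
def avoidE : NE :=
  .cond (safeE 0 1) <| .ex 2 numE <| .cond (.read 2 (.add (.mul numE (.var 0)) (.var 2))) <|
    .all 3 (lenE 2) <| .ex 4 powE <| .cond (.not (lossE 2 4)) <| .all 5 (lenE 2) <|
      .imp (.cond (nextE 0 1 2 5) (.add (.lt (.var 2) actE) (.eq (.var 3) (.var 5)))) (bitE 4 5)
/-- The next contents of table `3`, in cell number `13`. -/
def tableE : NE :=
  .not <| .ex 0 numE <| .ex 1 powE <|
    .cond (.eq (.var 13) (.add (.mul powE (.var 0)) (.var 1))) avoidE
/-- The answer. -/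
def answerE : NE :=
  .not <| .ex 0 numE <| .ex 6 (lenE 0) <| .cond (matNe (entryE (opE 0 6))) <|
    .ex 1 powE <| .cond (bitE 1 6) (.not (lossE 0 1))

variable {M : QMDP} {B : Submodule ℂ (EuclideanSpace ℂ (Fin M.dim))} {G : Tables} {v : ℕ → ℕ}

theorem eval_opE (h : M.IsInput B G) {x : M.Choice} {a i : ℕ} (ha : a ≠ 20) (hx : v a = M.code x) :
    (opE a i).eval G v = ∑ z ∈ Finset.range (M.code x), G.nat 1 z + v i := by
  simp only [opE, NE.eval, lenE, Function.update_self, NE.lt, Function.update_of_ne ha, hx]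
  congr 1
  have hle : M.code x ≤ G.bound := (M.code_lt x).le.trans h.numChoices_le
  rw [← Finset.sum_filter]
  refine Finset.sum_congr ?_ fun _ _ => rfl
  ext z
  simp only [Finset.mem_filter, Finset.mem_range]
  omega

theorem eval_dimE (h : M.IsInput B G) : dimE.eval G v = M.dim := by simp [dimE, NE.eval, h.dim]

/-- The expressions `L` give the entries of `A` whenever the variables agree with `v` up to the
numbers `8`, `9`, `10`. -/
def Entries (G : Tables) (v : ℕ → ℕ) {d : ℕ} (A : Matrix (Fin d) (Fin d) ℂ)
    (L : ℕ → ℕ → ℕ → RE) : Prop :=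
  ∀ (u : ℕ → ℕ), (∀ a, a ≠ 8 → a ≠ 9 → a ≠ 10 → u a = v a) → ∀ (a b : ℕ) (r c : Fin d),
    u a = r → u b = c → (L a b 0).eval G u = (A r c).re ∧ (L a b 1).eval G u = (A r c).im

theorem entries_entryE (h : M.IsInput B G) {x : M.Choice} {k : Fin (M.fam x).len} {a i : ℕ}
    (ha : a ≠ 8 ∧ a ≠ 9 ∧ a ≠ 10 ∧ a ≠ 20) (hi : i ≠ 8 ∧ i ≠ 9 ∧ i ≠ 10) (hx : v a = M.code x)
    (hk : v i = k) : Entries G v (M.kraus x k) (entryE (opE a i)) := by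
  intro u hu p q r c hp hq
  have hd := h.dim_le x
  have hde : dimE.eval G u ≤ G.bound := by rw [eval_dimE h]; exact hd
  have ho := eval_opE (v := u) (i := i) h ha.2.2.2 ((hu a ha.1 ha.2.1 ha.2.2.1).trans hx)
  rw [hu i hi.1 hi.2.1 hi.2.2, hk] at ho
  have hidx : ∀ t, NE.eval G u (.add (dbl (.add (.mul dimE (.add (.mul dimE (opE a i)) (.var p))) (.var q)))
      (.lit t)) = 2 * (M.dim * (M.dim * (∑ z ∈ Finset.range (M.code x), G.nat 1 z + k.1) + r.1) + c.1) + t := by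
    intro t
    simp only [NE.eval.eq_4, dbl, NE.eval_mul_of_le hde, eval_dimE h, ho]
    simp only [NE.eval, hp, hq]
    ring
  constructor
  · rw [entryE, RE.eval, hidx]; exact h.op_re x k r c
  · rw [entryE, RE.eval, hidx]; exact h.op_im x k r c

theorem entries_projE (h : M.IsInput B G) (x : M.Choice) : Entries G v (projMatrix B) projE := by
  intro u hu p q r c hp hq
  have hde : dimE.eval G u ≤ G.bound := by rw [eval_dimE h]; exact h.dim_le x
  have hidx : ∀ t, NE.eval G u (.add (dbl (.add (.mul dimE (.var p)) (.var q)))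
      (.lit t)) = 2 * (M.dim * r.1 + c.1) + t := by
    intro t
    simp only [NE.eval.eq_4, dbl, NE.eval_mul_of_le hde, eval_dimE h]
    simp only [NE.eval, hp, hq]
    ring
  constructor
  · rw [projE, RE.eval, hidx]; exact h.proj_re r c
  · rw [projE, RE.eval, hidx]; exact h.proj_im r c

theorem sum_range_eq_sum_fin {d n : ℕ} (hd : d ≤ n) (f : ℕ → ℝ) :
    (∑ m ∈ Finset.range n, if m < d then f m else 0) = ∑ m : Fin d, f m := by
  rw [← Finset.sum_filter, Fin.sum_univ_eq_sum_range f d]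
  refine Finset.sum_congr ?_ fun _ _ => rfl
  ext z
  simp only [Finset.mem_filter, Finset.mem_range]
  omega

theorem entries_prodE (h : M.IsInput B G) (x : M.Choice) {A C : Matrix (Fin M.dim) (Fin M.dim) ℂ}
    {L R : ℕ → ℕ → ℕ → RE} (hL : Entries G v A L) (hR : Entries G v C R) :
    ∀ (u : ℕ → ℕ), (∀ a, a ≠ 8 → a ≠ 9 → a ≠ 10 → u a = v a) → ∀ (a b : ℕ) (r c : Fin M.dim),
      a ≠ 10 → b ≠ 10 → u a = r → u b = c →
      (prodE L R a b 0).eval G u = ((A * C) r c).re ∧ (prodE L R a b 1).eval G u = ((A * C) r c).im := by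
  intro u hu a b r c ha hb hr hc
  have hu' : ∀ m a, a ≠ 8 → a ≠ 9 → a ≠ 10 → Function.update u 10 m a = v a := by
    intro m a h8 h9 h10
    rw [Function.update_of_ne h10, hu a h8 h9 h10]
  have hl := fun m : Fin M.dim => hL _ (hu' m) a 10 r m (by rw [Function.update_of_ne ha, hr]) (by simp)
  have hr := fun m : Fin M.dim => hR _ (hu' m) 10 b m c (by simp) (by rw [Function.update_of_ne hb, hc])
  have hlt : ∀ m, NE.eval G (Function.update u 10 m) (.lt (.var 10) dimE) ≠ 0 ↔ m < M.dim := by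
    intro m
    have := NE.holds_lt (G := G) (v := Function.update u 10 m) (e := .var 10) (f := dimE)
    rwa [eval_dimE h, NE.eval, Function.update_self] at this
  constructor
  · simp only [prodE, RE.eval, hlt, if_true]
    rw [sum_range_eq_sum_fin (h.dim_le x), mul_apply, Complex.re_sum]
    refine Finset.sum_congr rfl fun m _ => ?_
    rw [(hl m).1, (hl m).2, (hr m).1, (hr m).2, Complex.mul_re]
  · simp only [prodE, RE.eval, hlt, if_neg one_ne_zero]
    rw [sum_range_eq_sum_fin (h.dim_le x), mul_apply, Complex.im_sum]
    refine Finset.sum_congr rfl fun m _ => ?_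
    rw [(hl m).1, (hl m).2, (hr m).1, (hr m).2, Complex.mul_im]

theorem holds_matNe (h : M.IsInput B G) (x : M.Choice) {A : Matrix (Fin M.dim) (Fin M.dim) ℂ}
    {L : ℕ → ℕ → ℕ → RE}
    (hL : ∀ (u : ℕ → ℕ), (∀ a, a ≠ 8 → a ≠ 9 → a ≠ 10 → u a = v a) → ∀ (r c : Fin M.dim),
      u 8 = r → u 9 = c → (L 8 9 0).eval G u = (A r c).re ∧ (L 8 9 1).eval G u = (A r c).im) :
    (matNe L).Holds G v ↔ A ≠ 0 := by
  have hd := h.dim_le x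
  have key : ∀ r c : Fin M.dim, (NE.add (.ne0 (L 8 9 0)) (.ne0 (L 8 9 1))).Holds G
      (Function.update (Function.update v 8 r) 9 c) ↔ A r c ≠ 0 := by
    intro r c
    obtain ⟨h1, h2⟩ := hL (Function.update (Function.update v 8 r) 9 c)
      (fun a h8 h9 _ => by rw [Function.update_of_ne h9, Function.update_of_ne h8]) r c
      (by simp) (by simp)
    rw [NE.holds_add, NE.holds_ne0, NE.holds_ne0, h1, h2, Ne, Ne, Ne, Complex.ext_iff, not_and_or]
    simp
  rw [matNe, NE.holds_ex hd fun _ => eval_dimE h]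
  simp only [NE.holds_ex hd fun _ => eval_dimE h]
  constructor
  · rintro ⟨r, hr, c, hc, hne⟩ rfl
    exact (key ⟨r, hr⟩ ⟨c, hc⟩).1 hne rfl
  · intro hA
    by_contra! hc
    refine hA ?_
    ext r c
    by_contra hrc
    exact hc r r.2 c c.2 ((key r c).2 hrc)

theorem holds_bitE (h : M.IsInput B G) {a b i c : ℕ} (x : M.Choice) (ha : a ≠ 11 ∧ a ≠ 12)
    (hb : b ≠ 11 ∧ b ≠ 12) (hi : v b = i) (hi' : i < M.maxLen) (hc : v a = c) (hc' : c < 2 ^ M.maxLen) :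
    (bitE a b).Holds G v ↔ c.testBit i = true := by
  have hP := h.twoPow_le x
  have hpi : 2 ^ i ≤ G.bound := (Nat.pow_le_pow_right (by norm_num) hi'.le).trans hP
  have hmul : ∀ p q, NE.eval G (Function.update (Function.update v 11 p) 12 q)
      (.mul (.read 4 (.var b)) (.add (dbl (.var 11)) (.lit 1))) = 2 ^ i * (2 * p + 1) := by
    intro p q
    have hr : NE.eval G (Function.update (Function.update v 11 p) 12 q) (.read 4 (.var b)) = 2 ^ i := by
      simp [NE.eval, hb.1, hb.2, hi, h.pow i hi']
    rw [NE.eval_mul_of_le (by rw [hr]; exact hpi), hr]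
    simp [NE.eval, dbl, two_mul]
  have hmain : (bitE a b).Holds G v ↔ ∃ p < G.bound, ∃ q < G.bound, q < 2 ^ i ∧
      c = 2 ^ i * (2 * p + 1) + q := by
    simp only [bitE, NE.holds_sum, NE.holds_cond, NE.holds_lt, NE.holds_eq]
    refine exists_congr fun p => and_congr_right fun _ => exists_congr fun q => and_congr_right fun _ => ?_
    rw [NE.eval, NE.eval, NE.eval, NE.eval, NE.eval.eq_4, hmul]
    simp [NE.eval, hb.1, hb.2, hi, h.pow i hi', ha.1, ha.2, hc]
  rw [hmain, Nat.testBit_eq_decide_div_mod_eq, decide_eq_true_iff]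
  constructor
  · rintro ⟨p, -, q, -, hq, rfl⟩
    rw [Nat.mul_add_div (by positivity), Nat.div_eq_of_lt hq]
    omega
  · intro hbit
    refine ⟨c / 2 ^ i / 2, ?_, c % 2 ^ i, ?_, Nat.mod_lt _ (by positivity), ?_⟩
    · exact ((Nat.div_le_self _ _).trans (Nat.div_le_self _ _)).trans_lt (hc'.trans_le hP)
    · exact (Nat.mod_le _ _).trans_lt (hc'.trans_le hP)
    · have h1 := Nat.div_add_mod c (2 ^ i)
      have h2 : 2 * (c / 2 ^ i / 2) + 1 = c / 2 ^ i := by omega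
      rw [h2, h1]

theorem eval_lenE (h : M.IsInput B G) {a : ℕ} {x : M.Choice} (hx : v a = M.code x) :
    (lenE a).eval G v = (M.fam x).len := by
  simp [lenE, NE.eval, hx, h.len]

theorem eval_numE (h : M.IsInput B G) : numE.eval G v = M.numAct + M.numMeas := by
  simp [numE, NE.eval, h.numAct, h.numMeas]

theorem eval_powE (h : M.IsInput B G) : powE.eval G v = 2 ^ M.maxLen := by
  simp [powE, NE.eval, h.twoPow]

/-- The set of operators with code `c`. -/
def bits (M : QMDP) (x : M.Choice) (c : ℕ) : Set (Fin (M.fam x).len) := {i | c.testBit i = true}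

theorem holds_safeE (h : M.IsInput B G) {a b c : ℕ} {x : M.Choice}
    (ha : a ≠ 6 ∧ a ≠ 8 ∧ a ≠ 9 ∧ a ≠ 10 ∧ a ≠ 20) (hb : b ≠ 6 ∧ b ≠ 11 ∧ b ≠ 12)
    (hx : v a = M.code x) (hc : v b = c) (hc' : c < 2 ^ M.maxLen) :
    (safeE a b).Holds G v ↔ ∀ i ∈ bits M x c, projMatrix B * M.kraus x i = 0 := by
  rw [safeE, NE.holds_all (h.len_le x) fun i =>
    eval_lenE h (by rw [Function.update_of_ne ha.1, hx])]
  have key : ∀ i : Fin (M.fam x).len, (NE.imp (bitE b 6) (.not (matNe (prodE projE (entryE (opE a 6)))))).Holds G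
      (Function.update v 6 i) ↔ (i ∈ bits M x c → projMatrix B * M.kraus x i = 0) := by
    intro i
    rw [NE.holds_imp, NE.holds_not, holds_bitE h x hb.2 (by decide) (Function.update_self ..)
      (i.2.trans_le (M.len_le_maxLen x)) (by rw [Function.update_of_ne hb.1, hc]) hc',
      holds_matNe h x (A := projMatrix B * M.kraus x i), not_not]
    · rfl
    · intro u hu r c' hr hc'
      exact entries_prodE h x (entries_projE h x)
        (entries_entryE h (x := x) (k := i) ha.2 (by decide) (by rw [Function.update_of_ne ha.1, hx]) (by simp))
        u hu 8 9 r c' (by decide) (by decide) hr hc'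
  exact ⟨fun H i => (key i).1 (H i i.2), fun H i hi => (key ⟨i, hi⟩).2 (H ⟨i, hi⟩)⟩

theorem holds_nextE (h : M.IsInput B G) {a b c a' b' : ℕ} {x y : M.Choice} {k : Fin (M.fam y).len}
    (ha : a ≠ 7 ∧ a ≠ 8 ∧ a ≠ 9 ∧ a ≠ 10 ∧ a ≠ 20) (hb : b ≠ 7 ∧ b ≠ 11 ∧ b ≠ 12)
    (ha' : a' ≠ 7 ∧ a' ≠ 8 ∧ a' ≠ 9 ∧ a' ≠ 10 ∧ a' ≠ 20) (hb' : b' ≠ 7 ∧ b' ≠ 8 ∧ b' ≠ 9 ∧ b' ≠ 10)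
    (hx : v a = M.code x) (hc : v b = c) (hc' : c < 2 ^ M.maxLen) (hy : v a' = M.code y)
    (hk : v b' = k) :
    (nextE a b a' b').Holds G v ↔ k ∈ M.next x (bits M x c) y := by
  rw [nextE, NE.holds_ex (h.len_le x) fun i =>
    eval_lenE h (by rw [Function.update_of_ne ha.1, hx])]
  have key : ∀ i : Fin (M.fam x).len, (NE.cond (bitE b 7)
      (matNe (prodE (entryE (opE a' b')) (entryE (opE a 7))))).Holds G
      (Function.update v 7 i) ↔ (i ∈ bits M x c ∧ M.kraus y k * M.kraus x i ≠ 0) := by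
    intro i
    rw [NE.holds_cond, holds_bitE h x hb.2 (by decide) (Function.update_self ..)
      (i.2.trans_le (M.len_le_maxLen x)) (by rw [Function.update_of_ne hb.1, hc]) hc',
      holds_matNe h x (A := M.kraus y k * M.kraus x i)]
    · rfl
    · intro u hu r c' hr hc'
      exact entries_prodE h x
        (entries_entryE h (x := y) (k := k) ha'.2 hb'.2 (by rw [Function.update_of_ne ha'.1, hy])
          (by rw [Function.update_of_ne hb'.1, hk]))
        (entries_entryE h (x := x) (k := i) ha.2 (by decide) (by rw [Function.update_of_ne ha.1, hx]) (by simp))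
        u hu 8 9 r c' (by decide) (by decide) hr hc'
  exact ⟨fun ⟨i, hi, H⟩ => ⟨⟨i, hi⟩, (key ⟨i, hi⟩).1 H⟩, fun ⟨i, H⟩ => ⟨i, i.2, (key i).2 H⟩⟩

theorem holds_lossE (h : M.IsInput B G) {a b c : ℕ} {x : M.Choice} (hx : v a = M.code x)
    (hc : v b = c) : (lossE a b).Holds G v ↔ G.nat 3 (2 ^ M.maxLen * M.code x + c) ≠ 0 := by
  rw [lossE, NE.holds_read, NE.eval.eq_4, NE.eval_mul_of_le (by rw [eval_powE h]; exact h.twoPow_le x),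
    eval_powE h]
  simp [NE.eval, hx, hc]

end Alg
end QMDP

/-! ### Stabilization -/

theorem Finset.eq_of_card_le_of_antitone {α : Type*} [Fintype α] {s : ℕ → Finset α} (hs : Antitone s)
    (hstep : ∀ n, s (n + 1) = s n → s (n + 2) = s (n + 1)) {n : ℕ} (hn : Fintype.card α ≤ n) :
    s n = s (Fintype.card α) := by
  have hconst : ∀ m, s (m + 1) = s m → ∀ j, s (m + j) = s m := by
    intro m hm j
    have h : ∀ j, s (m + j + 1) = s (m + j) := by
      intro j
      induction j with
      | zero => exact hm
      | succ j ih => exact hstep _ ih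
    induction j with
    | zero => rfl
    | succ j ih => exact (h j).trans ih
  obtain ⟨m, hm, hm'⟩ : ∃ m ≤ Fintype.card α, s (m + 1) = s m := by
    by_contra! hc
    have hcard : ∀ m ≤ Fintype.card α + 1, (s m).card + m ≤ Fintype.card α := by
      intro m
      induction m with
      | zero => exact fun _ => Finset.card_le_univ _
      | succ m ih =>
        intro hm
        have h1 := ih (by omega)
        have h2 := Finset.card_lt_card ((hs (Nat.le_succ m)).lt_of_ne (hc m (by omega)))
        simp only [Nat.succ_eq_add_one] at h2
        omega
    have := hcard _ le_rfl
    omega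
  have h1 := hconst m hm' (n - m)
  have h2 := hconst m hm' (Fintype.card α - m)
  rw [Nat.add_sub_cancel' (hm.trans hn)] at h1
  rw [Nat.add_sub_cancel' hm] at h2
  rw [h1, h2]

namespace QMDP
namespace Alg

open RealRAM

variable {M : QMDP} {B : Submodule ℂ (EuclideanSpace ℂ (Fin M.dim))} {G : Tables} {v : ℕ → ℕ}

theorem exists_bits_eq (M : QMDP) (x : M.Choice) (T : Set (Fin (M.fam x).len)) :
    ∃ c < 2 ^ M.maxLen, bits M x c = T := by
  classical
  refine ⟨Nat.ofBits fun i : Fin (M.fam x).len => decide (i ∈ T), ?_, ?_⟩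
  · exact (Nat.ofBits_lt_two_pow _).trans_le (Nat.pow_le_pow_right (by norm_num) (M.len_le_maxLen x))
  · ext i
    simp [bits]

/-- One step back from the nodes in `W`. -/
def StepBack (M : QMDP) (B : Submodule ℂ (EuclideanSpace ℂ (Fin M.dim))) (W : M.Choice → ℕ → Prop)
    (x : M.Choice) (c : ℕ) : Prop :=
  (∀ i ∈ bits M x c, projMatrix B * M.kraus x i = 0) ∧ ∃ y ∈ M.avail x, ∀ k, ∃ c' < 2 ^ M.maxLen,
    W y c' ∧ ∀ k', k' ∈ M.next x (bits M x c) y ∧ M.ev y k' = M.ev y k → k' ∈ bits M y c'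

theorem canAvoid_succ_iff (n : ℕ) (x : M.Choice) (c : ℕ) :
    M.CanAvoid B (n + 1) x (bits M x c) ↔
      StepBack M B (fun y c' => M.CanAvoid B n y (bits M y c')) x c := by
  refine and_congr_right fun _ => exists_congr fun y => and_congr_right fun _ => forall_congr' fun k => ?_
  constructor
  · intro h
    obtain ⟨c', hc', hb⟩ := exists_bits_eq M y {k' | k' ∈ M.next x (bits M x c) y ∧ M.ev y k' = M.ev y k}
    exact ⟨c', hc', by beta_reduce; rwa [hb], fun k' hk' => by rw [hb]; exact hk'⟩
  · rintro ⟨c', -, h, hsub⟩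
    exact h.anti hsub

theorem StepBack.congr {W W' : M.Choice → ℕ → Prop} (h : ∀ y, ∀ c < 2 ^ M.maxLen, W y c ↔ W' y c)
    (x : M.Choice) (c : ℕ) : StepBack M B W x c ↔ StepBack M B W' x c := by
  refine and_congr_right fun _ => exists_congr fun y => and_congr_right fun _ => forall_congr' fun k =>
    exists_congr fun c' => and_congr_right fun hc' => ?_
  rw [h y c' hc']

/-- The subspace can be avoided forever as soon as it can be avoided for as many steps as there are
nodes. -/
theorem forall_canAvoid {x : M.Choice} {c : ℕ} (hc : c < 2 ^ M.maxLen)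
    (h : M.CanAvoid B ((M.numAct + M.numMeas) * 2 ^ M.maxLen) x (bits M x c)) (n : ℕ) :
    M.CanAvoid B n x (bits M x c) := by
  classical
  let s : ℕ → Finset (M.Choice × Fin (2 ^ M.maxLen)) := fun n =>
    Finset.univ.filter fun ν => M.CanAvoid B n ν.1 (bits M ν.1 ν.2)
  have hs : Antitone s := fun m n hmn ν hν => by
    simp only [s, Finset.mem_filter, Finset.mem_univ, true_and] at hν ⊢
    exact hν.mono hmn
  have hstep : ∀ n, s (n + 1) = s n → s (n + 2) = s (n + 1) := by
    intro n hn
    have hW : ∀ y, ∀ c < 2 ^ M.maxLen, M.CanAvoid B (n + 1) y (bits M y c) ↔ M.CanAvoid B n y (bits M y c) := by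
      intro y c hc
      have := congrArg (fun t => (y, (⟨c, hc⟩ : Fin (2 ^ M.maxLen))) ∈ t) hn
      simpa [s] using this
    ext ⟨y, c⟩
    simp only [s, Finset.mem_filter, Finset.mem_univ, true_and]
    rw [canAvoid_succ_iff, canAvoid_succ_iff]
    exact StepBack.congr hW y c
  have hcard : Fintype.card (M.Choice × Fin (2 ^ M.maxLen)) = (M.numAct + M.numMeas) * 2 ^ M.maxLen := by
    simp
  rcases le_total n ((M.numAct + M.numMeas) * 2 ^ M.maxLen) with hn | hn
  · exact h.mono hn
  · have := Finset.eq_of_card_le_of_antitone hs hstep (n := n) (by rw [hcard]; exact hn)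
    rw [hcard] at this
    have hmem : (x, (⟨c, hc⟩ : Fin (2 ^ M.maxLen))) ∈ s n := by
      rw [this]
      simpa [s] using h
    simpa [s] using hmem

theorem holds_avoidE (h : M.IsInput B G) {x : M.Choice} {c : ℕ} (hx : v 0 = M.code x) (hc : v 1 = c)
    (hc' : c < 2 ^ M.maxLen) :
    avoidE.Holds G v ↔
      StepBack M B (fun y c' => G.nat 3 (2 ^ M.maxLen * M.code y + c') = 0) x c := by
  rw [avoidE, NE.holds_cond, holds_safeE h (by decide) (by decide) hx hc hc',
    NE.holds_ex h.numChoices_le fun _ => eval_numE h, exists_code_iff]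
  refine and_congr_right fun _ => exists_congr fun y => ?_
  rw [NE.holds_cond, NE.holds_read, NE.eval.eq_4,
    NE.eval_mul_of_le (by rw [eval_numE h]; exact h.numChoices_le), eval_numE h, NE.eval, NE.eval,
    Function.update_self, Function.update_of_ne (by decide), hx, h.avail]
  refine and_congr_right fun _ => ?_
  rw [NE.holds_all (h.len_le y) fun i => eval_lenE h (by simp), Fin.forall_iff]
  refine forall_congr' fun k => forall_congr' fun hk => ?_
  rw [NE.holds_ex (h.twoPow_le x) fun _ => eval_powE h]
  refine exists_congr fun c' => and_congr_right fun hc'' => ?_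
  rw [NE.holds_cond, NE.holds_not, holds_lossE h (x := y) (c := c') (by simp) (by simp), not_not]
  refine and_congr_right fun _ => ?_
  rw [NE.holds_all (h.len_le y) fun i => eval_lenE h (by simp), Fin.forall_iff]
  refine forall_congr' fun k' => forall_congr' fun hk' => ?_
  rw [NE.holds_imp, NE.holds_cond, holds_nextE h (x := x) (y := y) (k := ⟨k', hk'⟩) (c := c) (by decide)
    (by decide) (by decide) (by decide) (by simp [hx]) (by simp [hc]) hc' (by simp) (by simp),
    holds_bitE h x (i := k') (c := c') (by decide) (by decide) (by simp)
      (hk'.trans_le (M.len_le_maxLen y)) (by simp) hc'', ev_eq_ev_iff, NE.holds_add, NE.holds_lt,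
      NE.holds_eq]
  simp [NE.eval, actE, h.numAct, bits, Fin.ext_iff]

theorem tableE_eval_eq_zero_iff (h : M.IsInput B G) {x : M.Choice} {c : ℕ} (hc : c < 2 ^ M.maxLen)
    (hv : v 13 = 2 ^ M.maxLen * M.code x + c) :
    tableE.eval G v = 0 ↔
      StepBack M B (fun y c' => G.nat 3 (2 ^ M.maxLen * M.code y + c') = 0) x c := by
  have h1 : tableE.eval G v = 0 ↔ ¬ tableE.Holds G v := by rw [NE.Holds, not_not]
  rw [h1, tableE, NE.holds_not, not_not, NE.holds_ex h.numChoices_le fun _ => eval_numE h,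
    exists_code_iff]
  have key : ∀ y c', c' < 2 ^ M.maxLen → ((NE.cond (.eq (.var 13) (.add (.mul powE (.var 0)) (.var 1)))
      avoidE).Holds G (Function.update (Function.update v 0 (M.code y)) 1 c') ↔
      (x = y ∧ c = c') ∧ StepBack M B (fun y c' => G.nat 3 (2 ^ M.maxLen * M.code y + c') = 0) y c') := by
    intro y c' hc'
    rw [NE.holds_cond, NE.holds_eq, NE.eval.eq_4,
      NE.eval_mul_of_le (by rw [eval_powE h]; exact h.twoPow_le x), eval_powE h,
      holds_avoidE h (x := y) (c := c') (by simp) (by simp) hc']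
    refine and_congr_left fun _ => ?_
    simp only [NE.eval, Function.update_self]
    rw [Function.update_of_ne (by decide), Function.update_of_ne (by decide),
      Function.update_of_ne (by decide), Function.update_self, hv]
    constructor
    · intro he
      have hx : M.code x = M.code y := by
        have := congrArg (· / 2 ^ M.maxLen) he
        simpa [Nat.mul_add_div, Nat.div_eq_of_lt hc, Nat.div_eq_of_lt hc'] using this
      rw [hx] at he
      exact ⟨code_inj.1 hx, by omega⟩
    · rintro ⟨rfl, rfl⟩; rfl
  simp only [NE.holds_ex (h.twoPow_le x) fun _ => eval_powE h]
  constructor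
  · rintro ⟨y, c', hc', hh⟩
    obtain ⟨⟨rfl, rfl⟩, hs⟩ := (key y c' hc').1 hh
    exact hs
  · intro hs
    exact ⟨x, c, hc, (key x c hc).2 ⟨⟨rfl, rfl⟩, hs⟩⟩

/-- The tables with new contents of table `3`. -/
def withLoss (G : Tables) (L : ℕ → ℕ) : Tables := { G with nat := Function.update G.nat 3 L }

/-- The contents of table `3` after `n` rounds. -/
noncomputable def lossTable (G : Tables) : ℕ → ℕ → ℕ
  | 0 => fun _ => 0
  | n + 1 => fun j => if j < G.bound then
      tableE.eval (withLoss G (lossTable G n)) (Function.update 0 13 j) else 0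

theorem isInput_withLoss (h : M.IsInput B G) (L : ℕ → ℕ) : M.IsInput B (withLoss G L) := by
  obtain ⟨h1, h2, h3, h4, h5, h6, h7, h8, h9, h10, h11, h12, h13⟩ := h
  exact ⟨by simpa [withLoss] using h1, by simpa [withLoss] using h2, by simpa [withLoss] using h3,
    by simpa [withLoss] using h4, by simpa [withLoss] using h5, by simpa [withLoss] using h6,
    by simpa [withLoss] using h7, by simpa [withLoss] using h8, h9, h10,
    by simpa [withLoss] using h11, by simpa [withLoss] using h12, by simpa [withLoss] using h13⟩

theorem lossTable_eq_zero_iff (h : M.IsInput B G) (n : ℕ) (x : M.Choice) {c : ℕ}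
    (hc : c < 2 ^ M.maxLen) :
    lossTable G n (2 ^ M.maxLen * M.code x + c) = 0 ↔ M.CanAvoid B n x (bits M x c) := by
  induction n generalizing x c with
  | zero => simp [lossTable, CanAvoid]
  | succ n ih =>
    have hlt : 2 ^ M.maxLen * M.code x + c < G.bound := by
      have := M.code_lt x
      rw [Tables.bound, h.bound]
      nlinarith
    rw [canAvoid_succ_iff, lossTable]
    beta_reduce
    rw [if_pos hlt, tableE_eval_eq_zero_iff (isInput_withLoss h _) (x := x) hc (by simp)]
    refine StepBack.congr (fun y c' hc' => ?_) x c
    rw [← ih y hc']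
    simp [withLoss]

/-- The value of the last formula answers the question. -/
theorem answerE_eval (h : M.IsInput B G) (hB : M.Invariant B) (hR : M.RankOneKraus) (v : ℕ → ℕ) :
    (M.AlwaysReaches B → answerE.eval (withLoss G (lossTable G G.bound)) v = 1) ∧
    (¬ M.AlwaysReaches B → answerE.eval (withLoss G (lossTable G G.bound)) v = 0) := by
  have h' := isInput_withLoss h (lossTable G G.bound)
  set G' := withLoss G (lossTable G G.bound) with hG'
  have hiff : answerE.Holds G' v ↔ M.AlwaysReaches B := by
    rw [alwaysReaches_iff hB hR, answerE, NE.holds_not, NE.holds_ex h'.numChoices_le fun _ => eval_numE h',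
      exists_code_iff]
    refine not_congr (exists_congr fun x => ?_)
    rw [NE.holds_ex (h'.len_le x) fun i => eval_lenE h' (by simp), Fin.exists_iff]
    constructor
    · rintro ⟨i, hi, H⟩
      refine ⟨i, hi, ?_⟩
      rw [NE.holds_cond, holds_matNe h' x (A := M.kraus x ⟨i, hi⟩) (fun u hu r c hr hc =>
        entries_entryE h' (x := x) (k := ⟨i, hi⟩) (by decide) (by decide) (by simp) (by simp) u hu 8 9 r c hr hc),
        NE.holds_ex (h'.twoPow_le x) fun _ => eval_powE h'] at H
      obtain ⟨hne, c, hc, H⟩ := H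
      rw [NE.holds_cond, holds_bitE h' x (i := i) (c := c) (by decide) (by decide) (by simp)
        (hi.trans_le (M.len_le_maxLen x)) (by simp) hc, NE.holds_not,
        holds_lossE h' (x := x) (c := c) (by simp) (by simp), not_not] at H
      refine ⟨hne, fun n => ?_⟩
      have hl : lossTable G G.bound (2 ^ M.maxLen * M.code x + c) = 0 := by
        simpa [hG', withLoss] using H.2
      rw [lossTable_eq_zero_iff h _ x hc, Tables.bound, h.bound] at hl
      exact (forall_canAvoid hc hl n).anti (by rintro _ rfl; exact H.1)
    · rintro ⟨i, hi, hne, H⟩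
      refine ⟨i, hi, ?_⟩
      rw [NE.holds_cond, holds_matNe h' x (A := M.kraus x ⟨i, hi⟩) (fun u hu r c hr hc =>
        entries_entryE h' (x := x) (k := ⟨i, hi⟩) (by decide) (by decide) (by simp) (by simp) u hu 8 9 r c hr hc),
        NE.holds_ex (h'.twoPow_le x) fun _ => eval_powE h']
      obtain ⟨c, hc, hb⟩ := exists_bits_eq M x {⟨i, hi⟩}
      refine ⟨hne, c, hc, ?_⟩
      rw [NE.holds_cond, holds_bitE h' x (i := i) (c := c) (by decide) (by decide) (by simp)
        (hi.trans_le (M.len_le_maxLen x)) (by simp) hc, NE.holds_not,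
        holds_lossE h' (x := x) (c := c) (by simp) (by simp), not_not]
      refine ⟨?_, ?_⟩
      · have : (⟨i, hi⟩ : Fin (M.fam x).len) ∈ bits M x c := by rw [hb]; rfl
        exact this
      · have := (lossTable_eq_zero_iff h G.bound x hc).2 (by rw [hb]; exact H _)
        simpa [hG', withLoss] using this
  constructor
  · intro hA
    have := hiff.2 hA
    simp only [answerE, NE.Holds, NE.not, NE.eval] at this ⊢
    omega
  · intro hA
    by_contra hne
    exact hA (hiff.1 hne)

end Alg
end QMDP

/-! ### Reading the input -/

theorem List.getD_flatMap_of_getElem? {α β : Type*} {l : List α} {f : α → List β} {i : ℕ} {a : α}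
    (h : l[i]? = some a) {j : ℕ} (hj : j < (f a).length) (d : β) :
    (l.flatMap f).getD (∑ z ∈ Finset.range i, (l.map fun a => (f a).length).getD z 0 + j) d =
      (f a).getD j d := by
  induction l generalizing i with
  | nil => simp at h
  | cons b l ih =>
    cases i with
    | zero =>
      obtain rfl : b = a := by simpa using h
      rw [List.flatMap_cons, Finset.sum_range_zero, zero_add, List.getD_append _ _ _ _ hj]
    | succ i =>
      have h' : l[i]? = some a := by simpa using h
      rw [List.flatMap_cons, Finset.sum_range_succ', List.getD_append_right _ _ _ _ (by simp; omega),
        ← ih h']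
      congr 1
      simp only [List.map_cons, List.getD_cons_succ, List.getD_cons_zero]
      omega

theorem List.getD_flatMap_of_length_eq {α β : Type*} {l : List α} {f : α → List β} {n i : ℕ} {a : α}
    (hf : ∀ a, (f a).length = n) (h : l[i]? = some a) {j : ℕ} (hj : j < n) (d : β) :
    (l.flatMap f).getD (n * i + j) d = (f a).getD j d := by
  rw [← List.getD_flatMap_of_getElem? h (by rw [hf]; exact hj) d]
  congr 2
  have hi : i < l.length := (List.getElem?_eq_some_iff.1 h).1
  rw [Finset.sum_congr rfl (g := fun _ => n), Finset.sum_const, Finset.card_range, smul_eq_mul, mul_comm]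
  intro z hz
  have hz' : z < l.length := (Finset.mem_range.1 hz).trans hi
  simp [hf, hz']

namespace QMDP

open RealRAM

theorem length_matrixEntries {d : ℕ} (A : Matrix (Fin d) (Fin d) ℂ) :
    (matrixEntries A).length = d * (d * 2) := by
  simp [matrixEntries, List.length_flatMap]

theorem getD_matrixEntries {d : ℕ} (A : Matrix (Fin d) (Fin d) ℂ) (r c : Fin d) {q : ℕ} (hq : q < 2) :
    (matrixEntries A).getD (2 * (d * r + c) + q) 0 = [(A r c).re, (A r c).im].getD q 0 := by
  have hc : c.1 * 2 + q < d * 2 := by have := c.2; omega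
  have h1 : 2 * (d * r + c) + q = (d * 2) * r.1 + (2 * c.1 + q) := by ring
  rw [h1, matrixEntries, List.getD_flatMap_of_length_eq (a := r) (n := d * 2)
    (by intro r; simp [List.length_flatMap]) (by simp) (by omega),
    List.getD_flatMap_of_length_eq (a := c) (n := 2) (by intro c; rfl) (by simp) hq]

theorem choices_getElem? (M : QMDP) (x : M.Choice) : M.choices[M.code x]? = some x := by
  match x with
  | Sum.inl α => simp [choices, code, List.getElem?_append]
  | Sum.inr β => simp [choices, code]

theorem length_choices (M : QMDP) : M.choices.length = M.numAct + M.numMeas := by simp [choices]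

theorem getD_lens (M : QMDP) (x : M.Choice) :
    (M.choices.map fun x => (M.fam x).len).getD (M.code x) 0 = (M.fam x).len := by
  simp [List.getD_eq_getElem?_getD, choices_getElem?]

theorem getD_avail (M : QMDP) (x y : M.Choice) :
    (M.choices.flatMap fun x => M.choices.map fun y => if y ∈ M.avail x then 1 else 0).getD
      ((M.numAct + M.numMeas) * M.code x + M.code y) 0 = if y ∈ M.avail x then 1 else 0 := by
  rw [List.getD_flatMap_of_length_eq (a := x) (by intro x; simp [length_choices])
    (M.choices_getElem? x) (M.code_lt y)]
  simp [List.getD_eq_getElem?_getD, choices_getElem?]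

theorem getD_ops (M : QMDP) (x : M.Choice) (k : Fin (M.fam x).len) (r c : Fin M.dim) {q : ℕ}
    (hq : q < 2) :
    (M.choices.flatMap fun x => (List.finRange (M.fam x).len).flatMap fun k =>
        matrixEntries ((M.fam x).op k)).getD
      (2 * (M.dim * (M.dim * (∑ z ∈ Finset.range (M.code x),
        (M.choices.map fun x => (M.fam x).len).getD z 0 + k.1) + r.1) + c.1) + q) 0 =
      [(M.kraus x k r c).re, (M.kraus x k r c).im].getD q 0 := by
  set D := M.dim * (M.dim * 2) with hD
  have hrc : 2 * (M.dim * r.1 + c.1) + q < D := by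
    have h1 := r.2
    have h2 := c.2
    have h3 : M.dim * r.1 + M.dim ≤ M.dim * M.dim := by
      rw [← Nat.mul_succ]; exact Nat.mul_le_mul_left _ h1
    have : D = 2 * (M.dim * M.dim) := by rw [hD]; ring
    omega
  have hlen : ∀ x, ((List.finRange (M.fam x).len).flatMap fun k =>
      matrixEntries ((M.fam x).op k)).length = D * (M.fam x).len := by
    intro x
    simp [List.length_flatMap, length_matrixEntries, hD, mul_comm]
  have hsum : ∑ z ∈ Finset.range (M.code x), (M.choices.map fun x =>
      ((List.finRange (M.fam x).len).flatMap fun k => matrixEntries ((M.fam x).op k)).length).getD z 0 =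
      D * ∑ z ∈ Finset.range (M.code x), (M.choices.map fun x => (M.fam x).len).getD z 0 := by
    rw [Finset.mul_sum]
    refine Finset.sum_congr rfl fun z _ => ?_
    simp only [hlen, List.getD_eq_getElem?_getD, List.getElem?_map]
    cases M.choices[z]? <;> simp
  have hidx : 2 * (M.dim * (M.dim * (∑ z ∈ Finset.range (M.code x),
        (M.choices.map fun x => (M.fam x).len).getD z 0 + k.1) + r.1) + c.1) + q =
      ∑ z ∈ Finset.range (M.code x), (M.choices.map fun x =>
      ((List.finRange (M.fam x).len).flatMap fun k => matrixEntries ((M.fam x).op k)).length).getD z 0 +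
      (D * k.1 + (2 * (M.dim * r.1 + c.1) + q)) := by
    rw [hsum, hD]; ring
  have hlt : D * k.1 + (2 * (M.dim * r.1 + c.1) + q) < D * (M.fam x).len := by
    calc _ < D * k.1 + D := by omega
      _ = D * (k.1 + 1) := by ring
      _ ≤ _ := Nat.mul_le_mul_left _ k.2
  rw [hidx, List.getD_flatMap_of_getElem? (M.choices_getElem? x) (by rw [hlen]; exact hlt),
    List.getD_flatMap_of_length_eq (a := k) (n := D) (fun _ => length_matrixEntries _) (by simp) hrc]
  exact getD_matrixEntries _ r c hq

theorem dim_le_len {M : QMDP} (hR : M.RankOneKraus) (x : M.Choice) : M.dim ≤ (M.fam x).len := by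
  choose φ η h using hR x
  let H : Matrix (Fin (M.fam x).len) (Fin M.dim) ℂ := Matrix.of η
  have hinj : Function.Injective H.mulVecLin := by
    rw [← LinearMap.ker_eq_bot, LinearMap.ker_eq_bot']
    intro v hv
    have hk : ∀ k, M.kraus x k *ᵥ v = 0 := by
      intro k
      have : η k ⬝ᵥ v = 0 := congrFun hv k
      rw [h k, vecMulVec_mulVec, this]
      simp
    rw [← one_mulVec v, ← M.sum_kraus x, sum_mulVec]
    exact Finset.sum_eq_zero fun k _ => by rw [← mulVec_mulVec, hk, mulVec_zero]
  have := LinearMap.finrank_le_finrank_of_injective hinj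
  simpa using this

theorem sup_lens (M : QMDP) : (Finset.range (M.numAct + M.numMeas)).sup
    (fun i => (M.choices.map fun x => (M.fam x).len).getD i 0) = M.maxLen := by
  apply le_antisymm
  · refine Finset.sup_le fun i hi => ?_
    obtain ⟨x, hx⟩ := (M.exists_code_iff (p := fun j => j = i)).1 ⟨i, Finset.mem_range.1 hi, rfl⟩
    rw [← hx, getD_lens]
    exact M.len_le_maxLen x
  · refine Finset.sup_le fun x _ => ?_
    rw [← getD_lens]
    exact Finset.le_sup (f := fun i => (M.choices.map fun x => (M.fam x).len).getD i 0)
      (Finset.mem_range.2 (M.code_lt x))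

theorem rankOneKraus_of {M : QMDP} (h₁ : ∀ α, (M.act α).RankOne) (h₂ : ∀ β, (M.meas β).RankOne) :
    M.RankOneKraus := by
  intro x k
  obtain ⟨a, φ, ψ, h⟩ : ∃ (a : ℂ) (φ ψ : Fin M.dim → ℂ), M.kraus x k = a • vecMulVec φ (star ψ) := by
    match x, k with
    | Sum.inl α, k => exact h₁ α k
    | Sum.inr β, k => exact h₂ β k
  exact ⟨a • φ, star ψ, by rw [h, smul_vecMulVec]⟩

end QMDP

namespace QMDP
namespace Alg

open RealRAM

/-! ### The program -/

/-- The maximal number of operators, left in cell `1` of the stack. -/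
def maxProg : Prog :=
  .while (.natLt (top 0) (.add (.read 1 (.lit 1)) (.read 1 (.lit 2)))) <|
    .seq (.ite (.natLt (top 1) (.read 2 (top 0))) (.setNat 0 (.lit 1) (.read 2 (top 0))) .skip)
      (.setNat 0 (.lit 0) (.add (top 0) (.lit 1)))

/-- The powers of two, the number of codes, and the number of nodes. -/
def powProg : Prog :=
  .seq (.setNat 0 (.lit 0) (.lit 0)) <| .seq (.setNat 1 (.lit 4) (.lit 1)) <|
  .seq (.setNat 1 (.lit 3) (.add (.read 1 (.lit 1)) (.read 1 (.lit 2)))) <|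
  .while (.natLt (top 0) (top 1)) <|
    .seq (.setNat 7 (top 0) (.read 1 (.lit 4))) <|
    .seq (.setNat 1 (.lit 4) (.add (.read 1 (.lit 4)) (.read 1 (.lit 4)))) <|
    .seq (.setNat 1 (.lit 3) (.add (.read 1 (.lit 3)) (.read 1 (.lit 3)))) <|
      .setNat 0 (.lit 0) (.add (top 0) (.lit 1))

theorem runs_maxProg {s : Store} (h0 : s.nat 0 0 = 0) (h1 : s.nat 0 1 = 0) :
    Runs maxProg s ((s.nat 1 1 + s.nat 1 2) * 30 + 10) fun s' =>
      s'.nat 0 1 = (Finset.range (s.nat 1 1 + s.nat 1 2)).sup (s.nat 2) ∧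
      (∀ a, a ≠ 0 → s'.nat a = s.nat a) ∧ s'.real = s.real := by
  let I : ℕ → Store → Prop := fun i s' => s'.nat 0 0 = i ∧ s'.nat 0 1 = (Finset.range i).sup (s.nat 2) ∧
      (∀ a, a ≠ 0 → s'.nat a = s.nat a) ∧ s'.real = s.real
  have := Runs.while (T := 20) (n := s.nat 1 1 + s.nat 1 2)
    (b := .natLt (top 0) (.add (.read 1 (.lit 1)) (.read 1 (.lit 2))))
    (p := .seq (.ite (.natLt (top 1) (.read 2 (top 0))) (.setNat 0 (.lit 1) (.read 2 (top 0))) .skip)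
      (.setNat 0 (.lit 0) (.add (top 0) (.lit 1)))) I
    (fun i s' h _ => by simp [Test.holds, NatExpr.val, h.1, h.2.2.1]) ?_ (s := s)
    ⟨h0, by simpa using h1, fun _ _ => rfl, rfl⟩
  · refine this.mono ?_ fun s' h => h.2
    simp [Test.cost, NatExpr.cost]
    omega
  · rintro i s' hi ⟨g0, g1, g2, g3⟩
    refine Runs.mono (T := (6 + 6) + 6) (Q := I (i + 1)) ?_ (by omega) fun _ h => h
    refine Runs.seq (Q := fun s' => s'.nat 0 0 = i ∧ s'.nat 0 1 = (Finset.range (i + 1)).sup (s.nat 2) ∧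
      (∀ a, a ≠ 0 → s'.nat a = s.nat a) ∧ s'.real = s.real) ?_ ?_
    · refine Runs.ite (fun hb => ?_) fun hb => ?_
      · refine (Runs.setNat ⟨?_, ?_, fun a ha => ?_, g3⟩).mono (by simp [NatExpr.cost]) fun _ h => h
        · simpa [NatExpr.val] using g0
        · simp only [Test.holds, NatExpr.val, g0, g1, g2 2 (by decide)] at hb
          simp only [NatExpr.val, setNat_nat, if_true, Function.update_self, g0, g2 2 (by decide)]
          rw [Finset.range_add_one, Finset.sup_insert]
          exact (sup_eq_left.2 hb.le).symm
        · simpa [ha] using g2 a ha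
      · refine (Runs.skip ⟨g0, ?_, g2, g3⟩).mono (by omega) fun _ h => h
        simp only [Test.holds, NatExpr.val, g0, g1, g2 2 (by decide)] at hb
        rw [g1, Finset.range_add_one, Finset.sup_insert]
        exact (sup_eq_right.2 (not_lt.1 hb)).symm
    · rintro s₂ ⟨k0, k1, k2, k3⟩
      refine Runs.setNat ⟨?_, ?_, fun a ha => ?_, k3⟩
      · simp [NatExpr.val, k0]
      · simpa [NatExpr.val] using k1
      · simpa [ha] using k2 a ha

theorem runs_powProg {s : Store} {N : ℕ} (hN : s.nat 0 1 = N) :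
    Runs powProg s (N * 60 + 50) fun s' =>
      s'.nat 1 = Function.update (Function.update (s.nat 1) 4 (2 ^ N)) 3
        ((s.nat 1 1 + s.nat 1 2) * 2 ^ N) ∧
      (∀ j < N, s'.nat 7 j = 2 ^ j) ∧
      (∀ a, a ≠ 0 → a ≠ 1 → a ≠ 7 → s'.nat a = s.nat a) ∧ s'.real = s.real := by
  let I : ℕ → Store → Prop := fun i s' => s'.nat 0 0 = i ∧ s'.nat 0 1 = N ∧
      s'.nat 1 = Function.update (Function.update (s.nat 1) 4 (2 ^ i)) 3
        ((s.nat 1 1 + s.nat 1 2) * 2 ^ i) ∧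
      (∀ j < i, s'.nat 7 j = 2 ^ j) ∧
      (∀ a, a ≠ 0 → a ≠ 1 → a ≠ 7 → s'.nat a = s.nat a) ∧ s'.real = s.real
  let s₁ := ((s.setNat 0 0 0).setNat 1 4 1).setNat 1 3 (s.nat 1 1 + s.nat 1 2)
  have hI0 : I 0 s₁ := by
    refine ⟨by simp [s₁], by simp [s₁, hN], by simp [s₁], by simp, fun a h0 h1 _ => by simp [s₁, h0, h1], rfl⟩
  have := Runs.while (T := 40) (n := N) (b := .natLt (top 0) (top 1))
    (p := .seq (.setNat 7 (top 0) (.read 1 (.lit 4))) <|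
    .seq (.setNat 1 (.lit 4) (.add (.read 1 (.lit 4)) (.read 1 (.lit 4)))) <|
    .seq (.setNat 1 (.lit 3) (.add (.read 1 (.lit 3)) (.read 1 (.lit 3)))) <|
      .setNat 0 (.lit 0) (.add (top 0) (.lit 1))) I
    (fun i s' h _ => by simp [Test.holds, NatExpr.val, h.1, h.2.1]) ?_ hI0
  · refine Runs.mono (T := 3 + (3 + (7 + (N * (5 + 40) + 5)))) ?_ (by omega) fun s' h => h
    refine (Runs.setNat (Q := fun s' => s' = s.setNat 0 0 0) rfl).seq ?_
    rintro _ rfl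
    refine (Runs.setNat (Q := fun s' => s' = (s.setNat 0 0 0).setNat 1 4 1) rfl).seq ?_
    rintro _ rfl
    refine (Runs.setNat (Q := fun s' => s' = s₁) (by simp [NatExpr.val, s₁])).seq ?_
    rintro _ rfl
    exact this.mono le_rfl fun s' h => h.2.2
  · rintro i s' hi ⟨g0, g1, g2, g3, g4, g5⟩
    let t₁ := s'.setNat 7 i (2 ^ i)
    let t₂ := t₁.setNat 1 4 (2 ^ (i + 1))
    let t₃ := t₂.setNat 1 3 ((s.nat 1 1 + s.nat 1 2) * 2 ^ (i + 1))
    refine Runs.mono (T := 5 + (7 + (7 + 6))) (Q := I (i + 1)) ?_ (by omega) fun _ h => h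
    refine (Runs.setNat (Q := fun s' => s' = t₁) (by simp [NatExpr.val, t₁, g0, g2])).seq ?_
    rintro _ rfl
    refine (Runs.setNat (Q := fun s' => s' = t₂) ?_).seq ?_
    · simp [NatExpr.val, t₂, t₁, g2, pow_succ, mul_two]
    rintro _ rfl
    refine (Runs.setNat (Q := fun s' => s' = t₃) ?_).seq ?_
    · simp [NatExpr.val, t₃, t₂, t₁, g2, pow_succ, mul_two, mul_add]
    rintro _ rfl
    refine Runs.setNat ⟨?_, ?_, ?_, fun j hj => ?_, fun a h0 h1 h7 => ?_, g5⟩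
    · simp [NatExpr.val, t₃, t₂, t₁, g0]
    · simp [NatExpr.val, t₃, t₂, t₁, g1]
    · simp only [t₃, t₂, t₁, setNat_nat, if_true, g2]
      ext j
      by_cases h3 : j = 3
      · simp [h3]
      · by_cases h4 : j = 4
        · simp [h4]
        · simp [h3, h4]
    · rcases Nat.lt_succ_iff_lt_or_eq.1 hj with h | rfl
      · simp [t₃, t₂, t₁, h.ne, g3 j h]
      · simp [t₃, t₂, t₁]
    · simp [t₃, t₂, t₁, h0, h1, h7, g4]

/-- Compute the next table into array `5`. -/
def fillProg : Prog :=
  .seq (.setNat 4 (.lit 13) (.lit 0)) <|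
  .while (.natLt (.read 4 (.lit 13)) boundCell) <|
    .seq (tableE.comp 1) <| .seq (.setNat 5 (.read 4 (.lit 13)) (top 1)) <|
      .setNat 4 (.lit 13) (.add (.read 4 (.lit 13)) (.lit 1))

/-- Copy array `5` to array `6`, which holds table `3`. -/
def copyProg : Prog :=
  .seq (.setNat 4 (.lit 13) (.lit 0)) <|
  .while (.natLt (.read 4 (.lit 13)) boundCell) <|
    .seq (.setNat 6 (.read 4 (.lit 13)) (.read 5 (.read 4 (.lit 13)))) <|
      .setNat 4 (.lit 13) (.add (.read 4 (.lit 13)) (.lit 1))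

theorem runs_fillProg {s : Store} {G : Tables} {q : ℕ}
    (hs : Represents s G (Function.update 0 13 q)) :
    Runs fillProg s (G.bound * (tableE.time.eval G.bound + 30) + 10) fun s' =>
      s'.nat 0 0 = s.nat 0 0 ∧ Represents s' G (Function.update 0 13 G.bound) ∧
      ∀ j < G.bound, s'.nat 5 j = tableE.eval G (Function.update 0 13 j) := by
  let I : ℕ → Store → Prop := fun i s' => s'.nat 0 0 = s.nat 0 0 ∧
    Represents s' G (Function.update 0 13 i) ∧
    ∀ j < i, s'.nat 5 j = tableE.eval G (Function.update 0 13 j)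
  have hI0 : I 0 (s.setNat 4 13 0) := by
    refine ⟨by simp, ?_, by simp⟩
    simpa using hs.setVar 13 0
  have := Runs.while (T := tableE.time.eval G.bound + 15) (n := G.bound)
    (b := .natLt (.read 4 (.lit 13)) boundCell)
    (p := .seq (tableE.comp 1) <| .seq (.setNat 5 (.read 4 (.lit 13)) (top 1)) <|
      .setNat 4 (.lit 13) (.add (.read 4 (.lit 13)) (.lit 1))) I
    (fun i s' h _ => by simp [Test.holds, NatExpr.val, h.2.1.var, h.2.1.bound_eq]) ?_ hI0
  · refine Runs.mono (T := 3 + (G.bound * (5 + (tableE.time.eval G.bound + 15)) + 5)) ?_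
      (by nlinarith) fun s' h => h
    refine (Runs.setNat (Q := fun s' => s' = s.setNat 4 13 0) rfl).seq ?_
    rintro _ rfl
    exact this
  · rintro i s' hi ⟨g0, g1, g2⟩
    refine Runs.mono (T := tableE.time.eval G.bound + (5 + 6)) (Q := I (i + 1)) ?_ (by omega) fun _ h => h
    refine (NE.runs_comp tableE G _ 1 s' g1).seq ?_
    rintro s₁ ⟨h1, h2⟩
    have hr := h2.represents g1
    refine (Runs.setNat (Q := fun t => t = s₁.setNat 5 i (tableE.eval G (Function.update 0 13 i)))
      (by simp [NatExpr.val, hr.var, h1])).seq ?_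
    rintro _ rfl
    have hr' : Represents (s₁.setNat 5 i (tableE.eval G (Function.update 0 13 i))) G
        (Function.update 0 13 i) :=
      ⟨by simp [hr.var], fun a => by simp [tableArray_ne_five, hr.nat], hr.real⟩
    refine Runs.setNat ⟨?_, ?_, fun j hj => ?_⟩
    · simp [h2.stack 0 one_pos, g0]
    · simpa [NatExpr.val, hr.var] using hr'.setVar 13 (i + 1)
    · rcases Nat.lt_succ_iff_lt_or_eq.1 hj with h | rfl
      · simp [h.ne, h2.nat 5 (by decide), g2 j h]
      · simp

theorem Represents.setLoss {s : Store} {G : Tables} {L v : ℕ → ℕ}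
    (hs : Represents s (withLoss G L) v) (i x : ℕ) :
    Represents (s.setNat 6 i x) (withLoss G (Function.update L i x)) v := by
  refine ⟨by simpa using hs.var, fun a => ?_, hs.real⟩
  have h := hs.nat a
  by_cases ha : a = 3
  · subst ha
    have h6 : s.nat 6 = L := by simpa [tableArray, withLoss] using h
    simp [tableArray, withLoss, h6]
  · have h6 : tableArray a ≠ 6 := fun h6 => ha (tableArray_inj.1 (h6.trans rfl))
    simpa [h6, withLoss, ha] using h

theorem withLoss_bound (G : Tables) (L : ℕ → ℕ) : (withLoss G L).bound = G.bound := by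
  simp [withLoss, Tables.bound]

theorem runs_copyProg {s : Store} {G : Tables} {L : ℕ → ℕ} {q : ℕ}
    (hs : Represents s (withLoss G L) (Function.update 0 13 q)) :
    Runs copyProg s (G.bound * 30 + 10) fun s' => s'.nat 0 0 = s.nat 0 0 ∧
      Represents s' (withLoss G fun j => if j < G.bound then s.nat 5 j else L j)
        (Function.update 0 13 G.bound) := by
  let I : ℕ → Store → Prop := fun i s' => s'.nat 0 0 = s.nat 0 0 ∧ s'.nat 5 = s.nat 5 ∧
    Represents s' (withLoss G fun j => if j < i then s.nat 5 j else L j) (Function.update 0 13 i)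
  have hI0 : I 0 (s.setNat 4 13 0) := by
    refine ⟨by simp, by simp, ?_⟩
    simpa using hs.setVar 13 0
  have := Runs.while (T := 20) (n := G.bound)
    (b := .natLt (.read 4 (.lit 13)) boundCell)
    (p := .seq (.setNat 6 (.read 4 (.lit 13)) (.read 5 (.read 4 (.lit 13)))) <|
      .setNat 4 (.lit 13) (.add (.read 4 (.lit 13)) (.lit 1))) I
    (fun i s' h _ => by
      simp [Test.holds, NatExpr.val, h.2.2.var, h.2.2.bound_eq.trans (withLoss_bound _ _)]) ?_ hI0
  · refine Runs.mono (T := 3 + (G.bound * (5 + 20) + 5)) ?_ (by omega) fun s' h => h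
    refine (Runs.setNat (Q := fun s' => s' = s.setNat 4 13 0) rfl).seq ?_
    rintro _ rfl
    exact this.mono le_rfl fun s' h => ⟨h.1, h.2.2⟩
  · rintro i s' hi ⟨g0, g1, g2⟩
    refine Runs.mono (T := 6 + 6) (Q := I (i + 1)) ?_ (by omega) fun _ h => h
    refine (Runs.setNat (Q := fun t => t = s'.setNat 6 i (s.nat 5 i))
      (by simp [NatExpr.val, g2.var, g1])).seq ?_
    rintro _ rfl
    have hr := Represents.setLoss g2 i (s.nat 5 i)
    have hL : Function.update (fun j => if j < i then s.nat 5 j else L j) i (s.nat 5 i) =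
        fun j => if j < i + 1 then s.nat 5 j else L j := by
      ext j
      rcases lt_trichotomy j i with h | rfl | h
      · simp [h.ne, h, h.trans (Nat.lt_succ_self i)]
      · simp
      · rw [Function.update_of_ne h.ne', if_neg (by omega), if_neg (by omega)]
    rw [hL] at hr
    refine Runs.setNat ⟨by simp [g0], by simp [g1], ?_⟩
    simpa [NatExpr.val, g2.var] using hr.setVar 13 (i + 1)

/-- Iterate the computation of the table. -/
def iterProg : Prog :=
  .seq (.setNat 0 (.lit 0) (.lit 0)) <|
  .while (.natLt (top 0) boundCell) <|
    .seq fillProg <| .seq copyProg <| .setNat 0 (.lit 0) (.add (top 0) (.lit 1))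

theorem lossTable_of_le (G : Tables) (n : ℕ) {j : ℕ} (hj : G.bound ≤ j) : lossTable G n j = 0 := by
  cases n with
  | zero => rfl
  | succ n => rw [lossTable]; exact if_neg (by omega)

theorem runs_iterProg {s : Store} {G : Tables} {q : ℕ}
    (hs : Represents s (withLoss G (lossTable G 0)) (Function.update 0 13 q)) :
    Runs iterProg s (G.bound * (G.bound * (tableE.time.eval G.bound + 60) + 60) + 10) fun s' =>
      ∃ q, Represents s' (withLoss G (lossTable G G.bound)) (Function.update 0 13 q) := by
  let I : ℕ → Store → Prop := fun i s' => s'.nat 0 0 = i ∧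
    ∃ q, Represents s' (withLoss G (lossTable G i)) (Function.update 0 13 q)
  have hI0 : I 0 (s.setNat 0 0 0) :=
    ⟨by simp, q, ((SameBelow.refl 0 s).setNat le_rfl).represents hs⟩
  have := Runs.while (T := G.bound * (tableE.time.eval G.bound + 60) + 30) (n := G.bound)
    (b := .natLt (top 0) boundCell)
    (p := .seq fillProg <| .seq copyProg <| .setNat 0 (.lit 0) (.add (top 0) (.lit 1))) I
    (fun i s' h _ => by
      obtain ⟨h0, q, h1⟩ := h
      simp [Test.holds, NatExpr.val, h0, h1.bound_eq.trans (withLoss_bound _ _)]) ?_ hI0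
  · refine Runs.mono (T := 3 + (G.bound * (5 + (G.bound * (tableE.time.eval G.bound + 60) + 30)) + 5)) ?_
      (by nlinarith) fun s' h => h
    refine (Runs.setNat (Q := fun s' => s' = s.setNat 0 0 0) rfl).seq ?_
    rintro _ rfl
    exact this.mono le_rfl fun s' h => h.2
  · rintro i s' hi ⟨g0, q, g1⟩
    have hf := runs_fillProg g1
    rw [withLoss_bound] at hf
    refine Runs.mono (T := (G.bound * (tableE.time.eval G.bound + 30) + 10) + ((G.bound * 30 + 10) + 6))
      (Q := I (i + 1)) ?_ (by nlinarith) fun _ h => h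
    refine hf.seq ?_
    rintro s₁ ⟨h0, h1, h2⟩
    refine (runs_copyProg h1).seq ?_
    rintro s₂ ⟨k0, k1⟩
    have hL : (fun j => if j < G.bound then s₁.nat 5 j else lossTable G i j) = lossTable G (i + 1) := by
      ext j
      rw [lossTable]
      by_cases hj : j < G.bound
      · simp only [if_pos hj, h2 j hj]
      · simp only [if_neg hj, lossTable_of_le G i (not_lt.1 hj)]
    rw [hL] at k1
    refine Runs.setNat ⟨by simp [NatExpr.val, k0, h0, g0], G.bound, ?_⟩
    exact ((SameBelow.refl 0 s₂).setNat (Nat.zero_le _)).represents k1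

/-- The decision procedure. -/
def prog : Prog := .seq maxProg <| .seq powProg <| .seq iterProg <| answerE.comp 0

/-- The running time, given the time for the two formulas. -/
noncomputable def totalTime (p q : Polynomial ℕ) : Polynomial ℕ :=
  Polynomial.X * 30 + 10 + (Polynomial.X * 60 + 50) +
    (Polynomial.X * (Polynomial.X * (p + 60) + 60) + 10) + q

theorem eval_totalTime (p q : Polynomial ℕ) (X : ℕ) : (totalTime p q).eval X = (X * 30 + 10) +
    ((X * 60 + 50) + ((X * (X * (p.eval X + 60) + 60) + 10) + q.eval X)) := by
  simp only [totalTime, Polynomial.eval_add, Polynomial.eval_mul, Polynomial.eval_X,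
    Polynomial.eval_ofNat]
  ring

theorem maxLen_le_nodes (M : QMDP) : M.maxLen ≤ (M.numAct + M.numMeas) * 2 ^ M.maxLen := by
  rcases Nat.eq_zero_or_pos (M.numAct + M.numMeas) with h | h
  · have : M.maxLen = 0 := by rw [← sup_lens, h]; rfl
    omega
  · exact Nat.lt_two_pow_self.le.trans (Nat.le_mul_of_pos_left _ h)

/-- The tables of a store. -/
def tablesOf (s : Store) : Tables where
  nat a := s.nat (tableArray a)
  real a := s.real (realTableArray a)

theorem represents_tablesOf {s : Store} {v : ℕ → ℕ} (h : s.nat 4 = v) : Represents s (tablesOf s) v :=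
  ⟨h, fun _ => rfl, fun _ => rfl⟩

theorem decides (M : QMDP) (B : Submodule ℂ (EuclideanSpace ℂ (Fin M.dim))) (hB : M.Invariant B)
    (hR : M.RankOneKraus) : DecidesWithin prog (M.inputStore B) (M.AlwaysReaches B)
      ((totalTime tableE.time answerE.time).eval ((M.numAct + M.numMeas) * 2 ^ M.maxLen)) := by
  set X := (M.numAct + M.numMeas) * 2 ^ M.maxLen with hX
  have hCX : M.numAct + M.numMeas ≤ X := Nat.le_mul_of_pos_right _ (by positivity)
  have hNX : M.maxLen ≤ X := maxLen_le_nodes M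
  suffices H : Runs prog (M.inputStore B) ((X * 30 + 10) + ((X * 60 + 50) +
      ((X * (X * (tableE.time.eval X + 60) + 60) + 10) + answerE.time.eval X)))
      fun s' => (M.AlwaysReaches B → s'.nat 0 0 = 1) ∧ (¬ M.AlwaysReaches B → s'.nat 0 0 = 0) by
    obtain ⟨s', t, he, ht, h⟩ := H
    exact ⟨s', t, he, ht.trans (eval_totalTime _ _ X).ge, h⟩
  have hlens : (M.inputStore B).nat 2 = fun i => (M.choices.map fun x => (M.fam x).len).getD i 0 := rfl
  have h11 : (M.inputStore B).nat 1 1 = M.numAct := rfl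
  have h12 : (M.inputStore B).nat 1 2 = M.numMeas := rfl
  have hmax := runs_maxProg (s := M.inputStore B) rfl rfl
  rw [h11, h12, hlens, sup_lens] at hmax
  refine (hmax.mono (by omega) fun _ h => h).seq ?_
  rintro s₁ ⟨a1, a2, a3⟩
  have hpow := runs_powProg a1
  rw [a2 1 (by decide), h11, h12] at hpow
  refine (hpow.mono (by omega) fun _ h => h).seq ?_
  rintro s₂ ⟨b1, b2, b3, b4⟩
  have hnat : ∀ a, a ≠ 0 → a ≠ 1 → a ≠ 7 → s₂.nat a = (M.inputStore B).nat a :=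
    fun a h0 h1 h7 => (b3 a h0 h1 h7).trans (a2 a h0)
  have hreal : s₂.real = (M.inputStore B).real := b4.trans a3
  have hin : M.IsInput B (tablesOf s₂) := by
    have e1 : (tablesOf s₂).nat 1 = fun i => (M.choices.map fun x => (M.fam x).len).getD i 0 :=
      hnat 2 (by decide) (by decide) (by decide)
    have e2 : (tablesOf s₂).nat 2 = (M.inputStore B).nat 3 := hnat 3 (by decide) (by decide) (by decide)
    have e0 : (tablesOf s₂).nat 0 = s₂.nat 1 := rfl
    have e4 : (tablesOf s₂).nat 4 = s₂.nat 7 := rfl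
    have er : ∀ a, (tablesOf s₂).real a = (M.inputStore B).real (realTableArray a) := fun a => by
      rw [← hreal]; rfl
    refine ⟨?_, ?_, ?_, ?_, ?_, fun x => ?_, fun x y => ?_, fun i hi => ?_, fun r c => ?_, fun r c => ?_,
      fun x k r c => ?_, fun x k r c => ?_, fun x => ?_⟩
    · simp [e0, b1]
    · rw [e0, b1]; rfl
    · rw [e0, b1]; rfl
    · rw [e0, b1]; rfl
    · simp [e0, b1]
    · rw [e1]; exact M.getD_lens x
    · rw [e2]
      refine (not_congr (Eq.congr_left (M.getD_avail x y))).trans ?_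
      simp
    · rw [e4, b2 i hi]
    · rw [er]; exact getD_matrixEntries (projMatrix B) r c (q := 0) (by decide)
    · rw [er]; exact getD_matrixEntries (projMatrix B) r c (q := 1) (by decide)
    · rw [er, e1]; exact M.getD_ops x k r c (q := 0) (by decide)
    · rw [er, e1]; exact M.getD_ops x k r c (q := 1) (by decide)
    · have h3 : (tablesOf s₂).nat 0 3 = X := by simp [e0, b1, hX]
      rw [h3]
      exact (dim_le_len hR x).trans ((M.len_le_maxLen x).trans hNX)
  have hbound : (tablesOf s₂).bound = X := hin.bound
  have hv : s₂.nat 4 = Function.update (0 : ℕ → ℕ) 13 0 := by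
    rw [hnat 4 (by decide) (by decide) (by decide)]
    rw [Function.update_eq_self_iff.2 (show (0 : ℕ) = (0 : ℕ → ℕ) 13 from rfl)]
    rfl
  have hloss : withLoss (tablesOf s₂) (lossTable (tablesOf s₂) 0) = tablesOf s₂ := by
    have : (tablesOf s₂).nat 3 = fun _ => 0 := hnat 6 (by decide) (by decide) (by decide)
    simp only [withLoss, lossTable, ← this, Function.update_eq_self]
  have hiter := runs_iterProg (s := s₂) (G := tablesOf s₂) (q := 0)
    (by rw [hloss]; exact represents_tablesOf hv)
  have hans := answerE_eval hin hB hR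
  rw [hbound] at hiter hans
  refine hiter.seq ?_
  rintro s₃ ⟨q, hq⟩
  have hc := NE.runs_comp answerE _ _ 0 s₃ hq
  rw [withLoss_bound, hbound] at hc
  refine hc.mono le_rfl fun s' h => ?_
  rw [h.1]
  exact hans _

end Alg
end QMDP

theorem mainTheorem10 :
    ∃ (prog : RealRAM.Prog) (poly : Polynomial ℕ),
      ∀ (M : QMDP) (B : Submodule ℂ (EuclideanSpace ℂ (Fin M.dim))),
        M.Invariant B →
        (∀ α, (M.act α).RankOne) →
        (∀ β, (M.meas β).RankOne) →
        RealRAM.DecidesWithin prog (M.inputStore B) (M.AlwaysReaches B)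
          (poly.eval ((M.numAct + M.numMeas) * 2 ^ M.maxLen)) := by
  exact ⟨QMDP.Alg.prog, QMDP.Alg.totalTime QMDP.Alg.tableE.time QMDP.Alg.answerE.time,
    fun M B hB h₁ h₂ => QMDP.Alg.decides M B hB (QMDP.rankOneKraus_of h₁ h₂)⟩
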